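/- Let $n,s,k\ge 1$ be integers and let $\mathcal C$ be the class of all unions $S=\bigcup_{i=1}^k S_i$ of $k$ pairwise disjoint $s$-intervals $S_i=\{a_i,a_i+1,\dots,a_i+s-1\}\subseteq\{1,\dots,n\}$ (for $k=1$ this is the class of $s$-intervals). For an unknown support $S\in\mathcal C$ let $x_i=\mu$ if $i\in S$ and $x_i=0$ otherwise, with known $\mu>0$. One may take successive measurements $Y_j=x_{A_j}+\Gamma_j^{-1/2}W_j$, where the $W_j$ are i.i.d. standard normal and the coordinate $A_j$ and the precision $\Gamma_j>0$ may depend on the past observations. Let $m>0$ and $\delta\in(0,1]$. Consider the following procedure, in which all measurements have the same precision $\Gamma>0$. It makes queries $Q_1,Q_2,\dots\in\{1,\dots,n\}$, and each query $Q_t$ is answered by a sequential likelihood ratio test with target error probabilities $\alpha_t,\beta_t$: the coordinate $Q_t$ is measured repeatedly until the cumulative log-likelihood ratio of $N(\mu,\Gamma^{-1})$ against $N(0,\Gamma^{-1})$ of these measurements leaves the interval $\left(\log\frac{\beta_t}{1-\alpha_t},\ \log\frac{1-\beta_t}{\alpha_t}\right)$; the answer $\Psi_t$ is $0$ if it leaves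 at the lower end and $1$ if it leaves at the upper end. - Search phase: the coordinates $1,s+1,2s+1,\dots$ are queried in this order until $k$ of them have been answered by $1$. Here $\alpha_t=\delta/4n$, $\beta_t=\delta/2k$. - Refinement phase: for each coordinate $g$ found in the search phase, from left to right, the coordinates $g-1,g-2,\dots$ are queried until one is answered by $0$ or $s-1$ of them have been queried (none if $g=1$). Here $\alpha_t=\delta/4n$, $\beta_t=\delta/4|S|=\delta/4ks$. The procedure stops at the first $t\ge1$ for which at most one $S'\in\mathcal C$ satisfies $\Psi_i=\mathbf 1_{S'}(Q_i)$ for all $i\le t$. The estimator $\hat S$ is this $S'$ if there is exactly one, and $\emptyset$ otherwise. Suppose that $$\mu\ \ge\ \sqrt{\frac{2n}{sm}\log\frac{2k}{\delta}+\frac{2ks}{m}\log\frac{4n}{\delta}}\,.$$ Then, for every sufficiently small precision $\Gamma>0$, the procedure satisfies $$\max_{S\in\mathcal C}\mathbb P_S(\hat S\neq S)\le\delta\qquad\text{and}\qquad \mathbb E_S\Big(\sum_j\Gamma_j\Big)\le m\quad\text{for all }S\in\mathcal C,$$ where $\sum_j\Gamma_j$ is the total precision of all measurements taken until the procedure stops.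 -/

import Mathlib

open MeasureTheory ProbabilityTheory

namespace AdaptiveSensing

/-! ### Classes of supports; the coordinates are the integers from 1 to n -/

/-- The class of `s`-intervals `{i, i+1, …, i+s-1}` with `1 ≤ i ≤ n-s+1`. -/
def sIntervals (n s : ℕ) : Set (Finset ℕ) :=
  {S | ∃ i : ℕ, 1 ≤ i ∧ i + s ≤ n + 1 ∧ S = Finset.Ico i (i + s)}

/-- The class of unions of `k` disjoint `s`-intervals. -/
def unionsOfIntervals (n s k : ℕ) : Set (Finset ℕ) :=
  {S | ∃ I : Fin k → Finset ℕ, (∀ i, I i ∈ sIntervals n s) ∧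
    (∀ i j, i ≠ j → Disjoint (I i) (I j)) ∧ S = Finset.univ.biUnion I}

/-- For `k = 1` the class is that of `s`-intervals. -/
theorem unionsOfIntervals_one (n s : ℕ) : unionsOfIntervals n s 1 = sIntervals n s := by
  ext S
  constructor
  · rintro ⟨I, hI, -, rfl⟩
    simpa using hI 0
  · intro hS
    refine ⟨fun _ => S, fun _ => hS, fun i j hij => absurd (Subsingleton.elim i j) hij, ?_⟩
    simp

/-! ### Noiseless procedures -/

/-- The queries made so far, each with the answer (`true` for "signal") that was recorded for it,
in chronological order. -/
abbrev History : Type := List (ℕ × Bool)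

/-- `S'` is a member of the class `C` that agrees with all recorded answers. -/
def Consistent (C : Set (Finset ℕ)) (h : History) (S' : Finset ℕ) : Prop :=
  S' ∈ C ∧ ∀ p ∈ h, (p.2 = true ↔ p.1 ∈ S')

/-- The stopping criterion: at least one query has been made, and at most one member of the class
agrees with all answers. A procedure is run until this holds for the first time. -/
def Stopped (C : Set (Finset ℕ)) (h : History) : Prop :=
  h ≠ [] ∧ ∀ S₁ S₂, Consistent C h S₁ → Consistent C h S₂ → S₁ = S₂

open Classical in
/-- The estimate: the unique member of the class that agrees with all answers if there is
exactly one, and the empty set otherwise. -/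
noncomputable def estimate (C : Set (Finset ℕ)) (h : History) : Finset ℕ :=
  if hu : ∃! S', Consistent C h S' then hu.choose else ∅

/-- A coordinate-wise procedure: the class of supports, the next query as a function of the
previous queries and answers, and the target type I and type II error probabilities of the
test made for that query (also functions of the previous queries and answers). -/
structure Procedure where
  cls : Set (Finset ℕ)
  query : History → ℕ
  α : History → ℝ
  β : History → ℝ

/-! ### The noisy version of a procedure, with sequential likelihood ratio tests -/

/-- The signal with support `S` and magnitude `μ`. -/
def signal (μ : ℝ) (S : Finset ℕ) (i : ℕ) : ℝ := if i ∈ S then μ else 0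

/-- The log-likelihood ratio `log (f₁ y / f₀ y)` of one observation, where `f₀` and `f₁` are the
densities of `N(0, Γ⁻¹)` and `N(μ, Γ⁻¹)`. -/
noncomputable def llrIncrement (μ Γ y : ℝ) : ℝ :=
  Real.log (gaussianPDFReal μ (Γ⁻¹).toNNReal y / gaussianPDFReal 0 (Γ⁻¹).toNNReal y)

/-- Lower boundary `l = log (β / (1 - α))` of the test. -/
noncomputable def lowerBoundary (α β : ℝ) : ℝ := Real.log (β / (1 - α))

/-- Upper boundary `u = log ((1 - β) / α)` of the test. -/
noncomputable def upperBoundary (α β : ℝ) : ℝ := Real.log ((1 - β) / α)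

/-- What is known between two measurements: the outcomes of the completed tests, and the
cumulative log-likelihood ratio of the current test. -/
structure State where
  hist : History
  llr : ℝ

open Classical in
/-- One measurement. If the procedure has not stopped, the coordinate `q` that is currently queried
is observed as `y = x_q + Γ^(-1/2) w`, where `w` is the noise. If the cumulative log-likelihood
ratio leaves `(l, u)`, the test for `q` ends with answer 0 or 1, which becomes the recorded answer,
and the test for the next query begins. -/
noncomputable def step (D : Procedure) (μ Γ : ℝ) (S : Finset ℕ) (σ : State) (w : ℝ) : State :=
  if Stopped D.cls σ.hist then σ
  else
    let q := D.query σ.hist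
    let y := signal μ S q + (Real.sqrt Γ)⁻¹ * w
    let z := σ.llr + llrIncrement μ Γ y
    if z ≤ lowerBoundary (D.α σ.hist) (D.β σ.hist) then ⟨σ.hist ++ [(q, false)], 0⟩
    else if upperBoundary (D.α σ.hist) (D.β σ.hist) ≤ z then ⟨σ.hist ++ [(q, true)], 0⟩
    else ⟨σ.hist, z⟩

/-- The state after `j` measurements, when the noise in the successive measurements is
`w 0, w 1, …` and the support is `S`. -/
noncomputable def run (D : Procedure) (μ Γ : ℝ) (S : Finset ℕ) (w : ℕ → ℝ) : ℕ → State
  | 0 => ⟨[], 0⟩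
  | j + 1 => step D μ Γ S (run D μ Γ S w j) (w j)

open Classical in
/-- The precision used by the measurement with noise `w j`: it is `Γ` as long as the procedure has
not stopped, and `0` (no measurement) afterwards. -/
noncomputable def precision (D : Procedure) (μ Γ : ℝ) (S : Finset ℕ) (w : ℕ → ℝ) (j : ℕ) : ℝ :=
  if Stopped D.cls (run D μ Γ S w j).hist then 0 else Γ

open Classical in
/-- The estimator: the estimate at the time when the procedure stops (and the empty set if it
never does). -/
noncomputable def estimator (D : Procedure) (μ Γ : ℝ) (S : Finset ℕ) (w : ℕ → ℝ) : Finset ℕ :=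
  if hT : ∃ j, Stopped D.cls (run D μ Γ S w j).hist then
    estimate D.cls (run D μ Γ S w (Nat.find hT)).hist
  else ∅

/-- `W 0, W 1, …` are independent standard normal random variables. -/
def IsStdNormalNoise {Ω : Type*} [MeasurableSpace Ω] (P : Measure Ω) (W : ℕ → Ω → ℝ) : Prop :=
  (∀ j, Measurable (W j)) ∧ iIndepFun W P ∧ ∀ j, P.map (W j) = gaussianReal 0 1

/-! ### The two-phase procedure for unions of `k` disjoint `s`-intervals -/

/-- The coordinates recorded as signal, in chronological order. -/
def hits (h : History) : List ℕ := (h.filter fun p => p.2).map Prod.fst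

/-- The search phase lasts until `k` coordinates have been recorded as signal. -/
def InSearch (k : ℕ) (h : History) : Prop := (hits h).length < k

/-- The coordinates that may come next in the refinement phase: `c` lies to the left of a coordinate
`g` that was found in the search phase (the first `k` hits), at distance less than `s`, has not been
queried yet, and all coordinates strictly between `c` and `g` were recorded as signal. -/
def refinementCandidates (s k : ℕ) (h : History) : Set ℕ :=
  {c | 1 ≤ c ∧ ∃ g ∈ (hits h).take k, c < g ∧ g < c + s ∧
    (∀ b, (c, b) ∉ h) ∧ ∀ j, c < j → j < g → (j, true) ∈ h}

open Classical in
/-- The next query: in the search phase the coordinates `1, s+1, 2s+1, …` one after the other; in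
the refinement phase the smallest candidate, that is, the found coordinates are treated from left
to right, and from each one the procedure walks to the left, until a coordinate is recorded as zero
or `s - 1` coordinates have been queried. -/
noncomputable def intervalQuery (s k : ℕ) (h : History) : ℕ :=
  if InSearch k h then h.length * s + 1 else sInf (refinementCandidates s k h)

open Classical in
/-- The two-phase procedure, with type I error probabilities `δ/4n`, and type II error
probabilities `δ/2k` in the search phase and `δ/4|S| = δ/4ks` in the refinement phase. -/
noncomputable def intervalProcedure (n s k : ℕ) (δ : ℝ) : Procedure where
  cls := unionsOfIntervals n s k
  query := intervalQuery s k
  α := fun _ => δ / (4 * n)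
  β := fun h => if InSearch k h then δ / (2 * k) else δ / (4 * (k * s))

end AdaptiveSensing

open AdaptiveSensing

namespace AdaptiveSensing

/-! ### Gaussian integrals -/

/-! Put ρ = √Γ μ. Multiplied by the sign `dir`, the log-likelihood ratio of a test is, under either
hypothesis, a Gaussian walk with steps N(ρ²/2, ρ²) drifting to the correct boundary (`dir_mul_llr`).
Two martingales control it: the walk minus its drift, and exp(-walk). Instead of treating each
test's stopping time separately, each martingale is turned into a nonnegative potential on the
states of the whole run whose mean never increases; `sum_lintegral_add_le` adds up the steps.

Precision: the potential is a budget K, minus the charges for completed tests, minus the current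
walk. A test is charged its boundary height plus 2ρ, since the mean excess over the boundary, given
that it is crossed, is at most 2ρ (`integral_walk_le`). The potential falls by ρ²/2 in mean per
measurement, which gives expected precision at most 2K/μ². Errors: exp(-walk) gives Wald's bounds
β/(1-α) and α/(1-β) for a wrong answer, and the same bookkeeping sums them over the tests.

Both arguments need only a pathwise fact: along every history that can arise, with right or wrong
answers, the charges total at most K, respectively δ. This is combinatorial (`exists_twoPhase`). As
long as the search is unfinished and the procedure has not stopped, a grid point in {1,…,n} remains
(`next_grid_le`). Once nothing is left to refine, the answers determine the support
(`consistent_unique`), so the procedure has stopped. Hence there are at most (n-1)/s + 1 search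
queries and k(s-1) refinement queries, and `cost_budget` and `error_budget` do the arithmetic.

The stated constant is reached without loss because log(1-x) ≤ -x puts each boundary below log(1/β)
or log(1/α) by at least δ/4n, which pays for 2ρ when Γ is small. -/

lemma integrable_pow_mul_exp_neg_sq_div_two (j : ℕ) :
    Integrable fun w : ℝ => w ^ j * Real.exp (-w ^ 2 / 2) := by
  have h := integrable_rpow_mul_exp_neg_mul_sq (b := 1 / 2) (by norm_num) (s := j)
    (by linarith [(Nat.cast_nonneg j : (0 : ℝ) ≤ j)])
  refine h.congr (Filter.Eventually.of_forall fun w => ?_)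
  simp only [Real.rpow_natCast]
  congr 2
  ring

/-- The mean residual life of a standard normal variable beyond a level `y ≥ -1` is at most `2`. -/
lemma integral_Ioi_sub_mul_exp_le (y : ℝ) (hy : -1 ≤ y) :
    ∫ w in Set.Ioi y, (w - y - 2) * Real.exp (-w ^ 2 / 2) ≤ 0 := by
  have h0 := integrable_pow_mul_exp_neg_sq_div_two 0
  have h1 := integrable_pow_mul_exp_neg_sq_div_two 1
  have h2 := integrable_pow_mul_exp_neg_sq_div_two 2
  have hF : Integrable fun w : ℝ => (w - y) * Real.exp (-w ^ 2 / 2) := by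
    refine (h1.sub (h0.const_mul y)).congr (Filter.Eventually.of_forall fun w => ?_)
    simp only [Pi.sub_apply]
    ring
  have hF' : Integrable fun w : ℝ => (1 - (w - y) * w) * Real.exp (-w ^ 2 / 2) := by
    refine ((h0.sub h2).add (h1.const_mul y)).congr (Filter.Eventually.of_forall fun w => ?_)
    simp only [Pi.sub_apply, Pi.add_apply]
    ring
  have hG : Integrable fun w : ℝ => (w - y - 2) * Real.exp (-w ^ 2 / 2) := by
    refine (hF.sub (h0.const_mul 2)).congr (Filter.Eventually.of_forall fun w => ?_)
    simp only [Pi.sub_apply]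
    ring
  have hd : ∀ w : ℝ, HasDerivAt (fun w : ℝ => (w - y) * Real.exp (-w ^ 2 / 2))
      ((1 - (w - y) * w) * Real.exp (-w ^ 2 / 2)) w := by
    intro w
    have he : HasDerivAt (fun w : ℝ => Real.exp (-w ^ 2 / 2))
        (Real.exp (-w ^ 2 / 2) * (-w)) w := by
      have hq : HasDerivAt (fun w : ℝ => -w ^ 2 / 2) (-w) w :=
        (((hasDerivAt_pow 2 w).neg.div_const 2)).congr_deriv (by push_cast; ring)
      exact hq.exp
    exact (((hasDerivAt_id w).sub_const y).mul he).congr_deriv (by simp only [id]; ring)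
  have hint : ∫ w in Set.Ioi y, (1 - (w - y) * w) * Real.exp (-w ^ 2 / 2) = 0 := by
    rw [integral_Ioi_of_hasDerivAt_of_tendsto' (m := 0) (fun w _ => hd w) hF'.integrableOn
      (tendsto_zero_of_hasDerivAt_of_integrableOn_Ioi (a := y) (fun w _ => hd w) hF'.integrableOn
        hF.integrableOn)]
    simp
  calc ∫ w in Set.Ioi y, (w - y - 2) * Real.exp (-w ^ 2 / 2)
      -- A multiple of an exact derivative with integral zero dominates the integrand: with t = w -
      -- y and y ≥ -1, the difference of the polynomial factors is at least (t² - 3t + 3)/2 > 0.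
      ≤ ∫ w in Set.Ioi y, -(1 / 2) * ((1 - (w - y) * w) * Real.exp (-w ^ 2 / 2)) := by
        refine setIntegral_mono_on hG.integrableOn (hF'.const_mul _).integrableOn
          measurableSet_Ioi fun w hw => ?_
        have hw' : 0 < w - y := sub_pos.2 hw
        rw [← mul_assoc]
        refine mul_le_mul_of_nonneg_right ?_ (Real.exp_pos _).le
        nlinarith [sq_nonneg (w - y - 3 / 2), mul_nonneg hw'.le (by linarith : 0 ≤ y + 1)]
    _ = 0 := by rw [integral_const_mul, hint, mul_zero]

lemma integral_gaussian_overshoot_le (y : ℝ) (hy : -1 ≤ y) :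
    ∫ w, (Set.Ici y).indicator (fun w => w - y - 2) w ∂gaussianReal 0 1 ≤ 0 := by
  rw [integral_gaussianReal_eq_integral_smul one_ne_zero]
  have : ∀ w : ℝ, gaussianPDFReal 0 1 w • (Set.Ici y).indicator (fun w => w - y - 2) w
      = (Set.Ici y).indicator
        (fun w => (√(2 * Real.pi))⁻¹ * ((w - y - 2) * Real.exp (-w ^ 2 / 2))) w := by
    intro w
    by_cases hw : w ∈ Set.Ici y
    · simp only [Set.indicator_of_mem hw, gaussianPDFReal, smul_eq_mul]
      simp
      ring
    · simp [Set.indicator_of_notMem hw]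
  simp only [this]
  rw [integral_indicator measurableSet_Ici, integral_Ici_eq_integral_Ioi, integral_const_mul]
  exact mul_nonpos_of_nonneg_of_nonpos (by positivity) (integral_Ioi_sub_mul_exp_le y hy)

lemma integrable_id_gaussianReal : Integrable (fun w : ℝ => w) (gaussianReal 0 1) :=
  (memLp_id_gaussianReal (μ := 0) (v := 1) 1).integrable (by simp)

lemma map_sign_mul_gaussianReal {τ : ℝ} (hτ : τ = 1 ∨ τ = -1) :
    (gaussianReal 0 1).map (fun w => τ * w) = gaussianReal 0 1 := by
  rw [gaussianReal_map_const_mul]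
  rcases hτ with rfl | rfl
  · congr 1
    · simp
    · ext; simp
  · congr 1
    · simp
    · ext; simp

lemma lintegral_sign_mul_gaussianReal {τ : ℝ} (hτ : τ = 1 ∨ τ = -1) (f : ℝ → ENNReal)
    (hf : Measurable f) :
    ∫⁻ w, f (τ * w) ∂gaussianReal 0 1 = ∫⁻ w, f w ∂gaussianReal 0 1 := by
  conv_rhs => rw [← map_sign_mul_gaussianReal hτ]
  rw [lintegral_map hf (by fun_prop)]

/-- Expected value, after one Gaussian step with drift `ρ ^ 2 / 2`, of a potential that decreases
with the walk and has an allowance `2 * ρ` for the excess over the boundary `b`. -/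
lemma integral_walk_le {ρ ζ b : ℝ} (a : ℝ) (hρ : 0 < ρ) (hρ2 : ρ ≤ 2) (hb : ζ < b) :
    Integrable (fun w => a - (ζ + ρ * w + ρ ^ 2 / 2) +
      {w | b ≤ ζ + ρ * w + ρ ^ 2 / 2}.indicator
        (fun w => ζ + ρ * w + ρ ^ 2 / 2 - b - 2 * ρ) w) (gaussianReal 0 1) ∧
    ∫ w, (a - (ζ + ρ * w + ρ ^ 2 / 2) +
      {w | b ≤ ζ + ρ * w + ρ ^ 2 / 2}.indicator
        (fun w => ζ + ρ * w + ρ ^ 2 / 2 - b - 2 * ρ) w) ∂gaussianReal 0 1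
      ≤ a - ζ - ρ ^ 2 / 2 := by
  set y := (b - ζ - ρ ^ 2 / 2) / ρ with hy
  have hρy : ρ * y = b - ζ - ρ ^ 2 / 2 := by rw [hy]; field_simp
  -- One step from below b must cover at least -ρ²/2 by noise, which is -ρ/2 ≥ -1 standard
  -- deviations.
  have hy1 : -1 ≤ y := by
    rw [hy, le_div_iff₀ hρ]
    nlinarith
  clear_value y
  have hset : {w : ℝ | b ≤ ζ + ρ * w + ρ ^ 2 / 2} = Set.Ici y := by
    ext w
    simp only [Set.mem_ofPred_eq, Set.mem_Ici]
    rw [← mul_le_mul_iff_right₀ (b := y) hρ, hρy]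
    constructor <;> intro h <;> linarith
  have hi : ∀ w : ℝ, (Set.Ici y).indicator (fun w => ζ + ρ * w + ρ ^ 2 / 2 - b - 2 * ρ) w
      = ρ * (Set.Ici y).indicator (fun w => w - y - 2) w := by
    intro w
    by_cases hw : w ∈ Set.Ici y
    · simp only [Set.indicator_of_mem hw]
      linear_combination hρy
    · simp [Set.indicator_of_notMem hw]
  simp only [hset, hi]
  have i1 : Integrable (fun w => a - (ζ + ρ * w + ρ ^ 2 / 2)) (gaussianReal 0 1) :=
    (integrable_const a).sub (((integrable_const ζ).add (integrable_id_gaussianReal.const_mul ρ)).add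
      (integrable_const _))
  have i2 : Integrable (fun w => ρ * (Set.Ici y).indicator (fun w => w - y - 2) w)
      (gaussianReal 0 1) :=
    (((integrable_id_gaussianReal.sub (integrable_const y)).sub
      (integrable_const 2)).indicator measurableSet_Ici).const_mul ρ
  refine ⟨i1.add i2, ?_⟩
  rw [integral_add i1 i2, integral_const_mul]
  have e1 : ∫ w, (a - (ζ + ρ * w + ρ ^ 2 / 2)) ∂gaussianReal 0 1 = a - ζ - ρ ^ 2 / 2 := by
    have : (fun w : ℝ => a - (ζ + ρ * w + ρ ^ 2 / 2))
        = fun w => (a - ζ - ρ ^ 2 / 2) - ρ * w := by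
      ext w; ring
    rw [this, integral_sub (integrable_const _) (integrable_id_gaussianReal.const_mul ρ),
      integral_const_mul, integral_id_gaussianReal]
    simp
  rw [e1]
  have := mul_nonpos_of_nonneg_of_nonpos hρ.le (integral_gaussian_overshoot_le y hy1)
  linarith

/-- The drift is half the variance, so exp(-walk), the likelihood ratio of the false hypothesis
against the true one, is a martingale. -/
lemma lintegral_exp_neg_walk (a e ζ ρ : ℝ) (ha : 0 ≤ a) (he : 0 ≤ e) :
    ∫⁻ w, ENNReal.ofReal (a + e * Real.exp (-(ζ + ρ * w + ρ ^ 2 / 2))) ∂gaussianReal 0 1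
      = ENNReal.ofReal (a + e * Real.exp (-ζ)) := by
  have hi : Integrable (fun w => e * Real.exp (-ζ - ρ ^ 2 / 2) * Real.exp (-ρ * w))
      (gaussianReal 0 1) :=
    (integrable_exp_mul_gaussianReal (-ρ)).const_mul _
  have heq : (fun w : ℝ => a + e * Real.exp (-(ζ + ρ * w + ρ ^ 2 / 2)))
      = fun w => a + e * Real.exp (-ζ - ρ ^ 2 / 2) * Real.exp (-ρ * w) := by
    ext w
    rw [mul_assoc, ← Real.exp_add]
    congr 3
    ring
  have hmgf : ∫ w, Real.exp (-ρ * w) ∂gaussianReal 0 1 = Real.exp (ρ ^ 2 / 2) := by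
    have := congrFun (mgf_fun_id_gaussianReal (μ := 0) (v := 1)) (-ρ)
    simp only [mgf] at this
    rw [this]
    simp
  rw [← ofReal_integral_eq_lintegral_ofReal]
  · rw [heq, integral_add (integrable_const _) hi, integral_const_mul, hmgf, mul_assoc,
      ← Real.exp_add]
    simp
  · rw [heq]
    exact (integrable_const _).add hi
  · exact Filter.Eventually.of_forall fun w => by positivity

/-! ### Log-likelihood ratios -/

lemma llrIncrement_eq {μ Γ : ℝ} (hΓ : 0 < Γ) (y : ℝ) :
    llrIncrement μ Γ y = Γ * μ * y - Γ * μ ^ 2 / 2 := by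
  have hv : ((Γ⁻¹).toNNReal : ℝ) = Γ⁻¹ := Real.coe_toNNReal _ (inv_nonneg.2 hΓ.le)
  have hc : (√(2 * Real.pi * Γ⁻¹))⁻¹ ≠ 0 :=
    inv_ne_zero (Real.sqrt_pos.2 (by positivity)).ne'
  rw [llrIncrement, gaussianPDFReal, gaussianPDFReal, hv, mul_div_mul_left _ _ hc,
    ← Real.exp_sub, Real.log_exp]
  field_simp
  ring

/-- The direction in which the log-likelihood ratio drifts while `q` is measured. -/
noncomputable def dir (S : Finset ℕ) (q : ℕ) : ℝ := if q ∈ S then 1 else -1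

lemma dir_eq (S : Finset ℕ) (q : ℕ) : dir S q = 1 ∨ dir S q = -1 := by
  unfold dir; split_ifs <;> simp

/-- The sign makes the two hypotheses look alike, and by symmetry `dir S q * w` is again standard
normal, so both are handled by one computation. -/
lemma dir_mul_llr {μ Γ : ℝ} (hΓ : 0 < Γ) (S : Finset ℕ) (q : ℕ) (z w : ℝ) :
    dir S q * (z + llrIncrement μ Γ (signal μ S q + (√Γ)⁻¹ * w))
      = dir S q * z + √Γ * μ * (dir S q * w) + (√Γ * μ) ^ 2 / 2 := by
  have hs : √Γ ≠ 0 := (Real.sqrt_pos.2 hΓ).ne'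
  have h1 : Γ * (√Γ)⁻¹ = √Γ := by
    nth_rewrite 1 [← Real.mul_self_sqrt hΓ.le]
    field_simp
  rw [llrIncrement_eq hΓ, mul_pow, Real.sq_sqrt hΓ.le]
  unfold dir signal
  split_ifs
  · linear_combination μ * w * h1
  · linear_combination -(μ * w) * h1

/-! ### Reachable histories -/

/-- The histories that a procedure can produce. -/
inductive Reachable (D : Procedure) : History → Prop
  | nil : Reachable D []
  | append {h : History} (b : Bool) : Reachable D h → ¬ Stopped D.cls h →
      Reachable D (h ++ [(D.query h, b)])

/-- All recorded answers agree with `S`. -/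
def Correct (S : Finset ℕ) (h : History) : Prop := ∀ p ∈ h, (p.2 = true ↔ p.1 ∈ S)

lemma correct_append {S : Finset ℕ} {h : History} {q : ℕ} {b : Bool} :
    Correct S (h ++ [(q, b)]) ↔ Correct S h ∧ (b = true ↔ q ∈ S) := by
  simp [Correct, or_imp, forall_and]

/-- The sum of the costs `c h b` of the answers in a history whose last answer comes first. -/
noncomputable def spentRev (c : History → Bool → ℝ) : History → ℝ
  | [] => 0
  | p :: r => spentRev c r + c r.reverse p.2

/-- The sum of the costs of the answers in a history, where an answer `b` given after the history
`h` costs `c h b`. -/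
noncomputable def spent (c : History → Bool → ℝ) (h : History) : ℝ := spentRev c h.reverse

@[simp] lemma spent_nil (c : History → Bool → ℝ) : spent c [] = 0 := rfl

@[simp] lemma spent_append (c : History → Bool → ℝ) (h : History) (p : ℕ × Bool) :
    spent c (h ++ [p]) = spent c h + c h p.2 := by
  simp [spent, spentRev]

/-! ### Transitions of the run and the states that occur -/

section Dynamics

variable (D : Procedure) (μ Γ : ℝ) (S : Finset ℕ)

/-- The lower boundary of the current test. -/
noncomputable def lowerAt (h : History) : ℝ := lowerBoundary (D.α h) (D.β h)

/-- The upper boundary of the current test. -/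
noncomputable def upperAt (h : History) : ℝ := upperBoundary (D.α h) (D.β h)

/-- The cumulative log-likelihood ratio after one more measurement. -/
noncomputable def nextLlr (σ : State) (w : ℝ) : ℝ :=
  σ.llr + llrIncrement μ Γ (signal μ S (D.query σ.hist) + (√Γ)⁻¹ * w)

lemma step_of_stopped {σ : State} (h : Stopped D.cls σ.hist) (w : ℝ) :
    step D μ Γ S σ w = σ := by
  simp [step, h]

lemma step_of_le {σ : State} (h : ¬ Stopped D.cls σ.hist) {w : ℝ}
    (hz : nextLlr D μ Γ S σ w ≤ lowerAt D σ.hist) :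
    step D μ Γ S σ w = ⟨σ.hist ++ [(D.query σ.hist, false)], 0⟩ := by
  unfold nextLlr lowerAt at hz
  simp [step, h, hz]

lemma step_of_ge {σ : State} (h : ¬ Stopped D.cls σ.hist) {w : ℝ}
    (hz : ¬ nextLlr D μ Γ S σ w ≤ lowerAt D σ.hist)
    (hz' : upperAt D σ.hist ≤ nextLlr D μ Γ S σ w) :
    step D μ Γ S σ w = ⟨σ.hist ++ [(D.query σ.hist, true)], 0⟩ := by
  unfold nextLlr lowerAt at hz
  unfold nextLlr upperAt at hz'
  simp only [step, h, hz, hz', if_true, if_false]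

lemma step_of_between {σ : State} (h : ¬ Stopped D.cls σ.hist) {w : ℝ}
    (hz : ¬ nextLlr D μ Γ S σ w ≤ lowerAt D σ.hist)
    (hz' : ¬ upperAt D σ.hist ≤ nextLlr D μ Γ S σ w) :
    step D μ Γ S σ w = ⟨σ.hist, nextLlr D μ Γ S σ w⟩ := by
  unfold nextLlr lowerAt at hz
  unfold nextLlr upperAt at hz'
  simp only [step, h, hz, hz', if_false, nextLlr]

/-- The states that can occur. -/
def Valid (σ : State) : Prop :=
  Reachable D σ.hist ∧
    (Stopped D.cls σ.hist ∨ lowerAt D σ.hist < σ.llr ∧ σ.llr < upperAt D σ.hist)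

variable {D}

lemma Valid.step {σ : State} (hσ : Valid D σ) (hl : ∀ h, lowerAt D h < 0)
    (hu : ∀ h, 0 < upperAt D h) (w : ℝ) : Valid D (step D μ Γ S σ w) := by
  by_cases hs : Stopped D.cls σ.hist
  · rwa [step_of_stopped D μ Γ S hs]
  by_cases hz : nextLlr D μ Γ S σ w ≤ lowerAt D σ.hist
  · rw [step_of_le D μ Γ S hs hz]
    exact ⟨.append _ hσ.1 hs, Or.inr ⟨hl _, hu _⟩⟩
  by_cases hz' : upperAt D σ.hist ≤ nextLlr D μ Γ S σ w
  · rw [step_of_ge D μ Γ S hs hz hz']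
    exact ⟨.append _ hσ.1 hs, Or.inr ⟨hl _, hu _⟩⟩
  · rw [step_of_between D μ Γ S hs hz hz']
    exact ⟨hσ.1, Or.inr ⟨not_le.1 hz, not_le.1 hz'⟩⟩

/-! ### Measurability and the supermartingale argument -/

/-- Histories form a countable set and carry the discrete σ-algebra, so measurability may be checked
with the history fixed. -/
instance : MeasurableSpace State :=
  MeasurableSpace.comap (fun σ : State => (σ.hist, σ.llr))
    (@Prod.instMeasurableSpace History ℝ ⊤ _)

lemma measurable_of_sections {β : Type*} [MeasurableSpace β] {f : State → β}
    (hf : ∀ h, Measurable fun z => f ⟨h, z⟩) : Measurable f := by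
  let _ : MeasurableSpace History := ⊤
  have : Measurable fun p : History × ℝ => f ⟨p.1, p.2⟩ :=
    measurable_from_prod_countable_right hf
  exact this.comp (comap_measurable _)

lemma measurable_of_sections_prod {β : Type*} [MeasurableSpace β] {f : State × ℝ → β}
    (hf : ∀ h, Measurable fun p : ℝ × ℝ => f (⟨h, p.1⟩, p.2)) : Measurable f := by
  let _ : MeasurableSpace History := ⊤
  have h1 : Measurable fun p : History × (ℝ × ℝ) => f (⟨p.1, p.2.1⟩, p.2.2) :=
    measurable_from_prod_countable_right hf
  have h2 : Measurable fun σ : State => (σ.hist, σ.llr) := comap_measurable _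
  have h3 : Measurable fun p : State × ℝ => (p.1.hist, (p.1.llr, p.2)) :=
    (measurable_fst.comp (h2.comp measurable_fst)).prodMk
      ((measurable_snd.comp (h2.comp measurable_fst)).prodMk measurable_snd)
  exact h1.comp h3

lemma measurable_mk (h : History) : Measurable (State.mk h) := by
  let _ : MeasurableSpace History := ⊤
  rw [measurable_comap_iff]
  exact measurable_const.prodMk measurable_id

lemma measurable_hist_pred (p : History → Prop) : MeasurableSet {σ : State | p σ.hist} := by
  refine measurableSet_setOfPred.2 (measurable_of_sections fun h => ?_)
  exact (measurable_const : Measurable fun _ : ℝ => p h)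

variable (D) in
lemma measurable_step : Measurable fun p : State × ℝ => step D μ Γ S p.1 p.2 := by
  refine measurable_of_sections_prod fun h => ?_
  by_cases hs : Stopped D.cls h
  · simp only [step, hs, if_true]
    exact (measurable_mk h).comp measurable_fst
  · simp only [step, hs, if_false]
    have hz : Measurable fun p : ℝ × ℝ =>
        p.1 + llrIncrement μ Γ (signal μ S (D.query h) + (√Γ)⁻¹ * p.2) := by
      have : Measurable (llrIncrement μ Γ) := by
        unfold llrIncrement
        exact Real.measurable_log.comp
          ((measurable_gaussianPDFReal _ _).div (measurable_gaussianPDFReal _ _))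
      exact measurable_fst.add (this.comp (measurable_const.add (measurable_snd.const_mul _)))
    exact Measurable.ite (measurableSet_le hz measurable_const) measurable_const
      (Measurable.ite (measurableSet_le measurable_const hz) measurable_const
        ((measurable_mk h).comp hz))

variable (D) in
lemma run_congr {w w' : ℕ → ℝ} {j : ℕ} (h : ∀ i < j, w i = w' i) :
    run D μ Γ S w j = run D μ Γ S w' j := by
  induction j with
  | zero => rfl
  | succ j ih => rw [run, run, ih fun i hi => h i (by omega), h j (by omega)]

variable (D) in
lemma measurable_run (j : ℕ) : Measurable fun w : ℕ → ℝ => run D μ Γ S w j := by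
  induction j with
  | zero => exact measurable_const
  | succ j ih => exact (measurable_step D μ Γ S).comp (ih.prodMk (measurable_pi_apply j))

variable {Ω : Type*} [MeasurableSpace Ω] {P : Measure Ω}
  {W : ℕ → Ω → ℝ}

lemma measurable_run_noise (D : Procedure) (hW : IsStdNormalNoise P W) (j : ℕ) :
    Measurable fun ω => run D μ Γ S (fun i => W i ω) j :=
  (measurable_run D μ Γ S j).comp (measurable_pi_lambda _ hW.1)

lemma indepFun_run (D : Procedure) (hW : IsStdNormalNoise P W) (j : ℕ) :
    IndepFun (fun ω => run D μ Γ S (fun i => W i ω) j) (W j) P := by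
  have h := hW.2.1.indepFun_finset (Finset.range j) {j} (by simp) hW.1
  -- The first j steps never read the noise from index j on, so padding by zeros exhibits the state
  -- as a function of `W 0, …, W (j-1)`.
  let ext : (Finset.range j → ℝ) → ℕ → ℝ := fun v i =>
    if hi : i ∈ Finset.range j then v ⟨i, hi⟩ else 0
  have hext : Measurable ext := by
    refine measurable_pi_lambda _ fun i => ?_
    by_cases hi : i ∈ Finset.range j
    · simpa only [ext, hi, dif_pos] using measurable_pi_apply (⟨i, hi⟩ : Finset.range j)
    · simpa only [ext, hi, dif_neg, not_false_eq_true] using measurable_const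
  have h' := h.comp ((measurable_run D μ Γ S j).comp hext)
    (measurable_pi_apply (⟨j, Finset.mem_singleton_self j⟩ : ({j} : Finset ℕ)))
  have he : (fun ω => run D μ Γ S (fun i => W i ω) j)
      = ((fun w => run D μ Γ S w j) ∘ ext) ∘ fun ω (i : Finset.range j) => W i ω := by
    funext ω
    refine run_congr D μ Γ S fun i hi => ?_
    simp [ext, hi]
  rw [he]
  exact h'

lemma lintegral_run_succ [IsProbabilityMeasure P] (D : Procedure) (hW : IsStdNormalNoise P W) (j : ℕ)
    {F : State → ENNReal} (hF : Measurable F) :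
    ∫⁻ ω, F (run D μ Γ S (fun i => W i ω) (j + 1)) ∂P
      = ∫⁻ ω, ∫⁻ w, F (step D μ Γ S (run D μ Γ S (fun i => W i ω) j) w) ∂gaussianReal 0 1 ∂P := by
  have hr := measurable_run_noise μ Γ S D hW j
  have hlaw := (indepFun_iff_map_prod_eq_prod_map_map hr.aemeasurable
    (hW.1 j).aemeasurable).1 (indepFun_run μ Γ S D hW j)
  rw [hW.2.2 j] at hlaw
  have hG : Measurable fun p : State × ℝ => F (step D μ Γ S p.1 p.2) :=
    hF.comp (measurable_step D μ Γ S)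
  calc ∫⁻ ω, F (run D μ Γ S (fun i => W i ω) (j + 1)) ∂P
      = ∫⁻ p, F (step D μ Γ S p.1 p.2)
          ∂P.map (fun ω => (run D μ Γ S (fun i => W i ω) j, W j ω)) := by
        rw [lintegral_map hG (hr.prodMk (hW.1 j))]
        rfl
    _ = _ := by
        rw [hlaw, lintegral_prod _ hG.aemeasurable, lintegral_map hG.lintegral_prod_right' hr]

/-- A nonnegative potential that decreases on average by at least `c` bounds the total of `c`. -/
lemma sum_lintegral_add_le [IsProbabilityMeasure P] (D : Procedure) (hW : IsStdNormalNoise P W) {F c : State → ENNReal}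
    (hF : Measurable F) (hc : Measurable c)
    (hstep : ∀ σ, ∫⁻ w, F (step D μ Γ S σ w) ∂gaussianReal 0 1 + c σ ≤ F σ) (J : ℕ) :
    ∑ j ∈ Finset.range J, ∫⁻ ω, c (run D μ Γ S (fun i => W i ω) j) ∂P
      + ∫⁻ ω, F (run D μ Γ S (fun i => W i ω) J) ∂P ≤ F ⟨[], 0⟩ := by
  induction J with
  | zero => simp [run]
  | succ J ih =>
    refine le_trans ?_ ih
    rw [Finset.sum_range_succ, add_assoc, lintegral_run_succ μ Γ S D hW J hF]
    gcongr
    rw [add_comm]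
    exact (lintegral_add_right _ (hc.comp (measurable_run_noise μ Γ S D hW J))).symm.trans_le
      (lintegral_mono fun ω => hstep _)

end Dynamics

section Guarantees

variable {D : Procedure} {μ Γ : ℝ} {S : Finset ℕ}

lemma dir_mul_nextLlr (hΓ : 0 < Γ) (σ : State) (w : ℝ) :
    dir S (D.query σ.hist) * nextLlr D μ Γ S σ w
      = dir S (D.query σ.hist) * σ.llr + √Γ * μ * (dir S (D.query σ.hist) * w)
        + (√Γ * μ) ^ 2 / 2 :=
  dir_mul_llr hΓ S _ _ w

/-! ### The expected total precision -/

open Classical in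
/-- The remaining budget, corrected for the progress of the current test. -/
noncomputable def costPotential (D : Procedure) (S : Finset ℕ) (c : History → Bool → ℝ) (K : ℝ)
    (σ : State) : ENNReal :=
  -- The value ⊤ at states that cannot occur makes the drift inequality trivial there, so it can be
  -- stated for all states.
  if Valid D σ then ENNReal.ofReal (K - spent c σ.hist
    - if Stopped D.cls σ.hist then 0 else dir S (D.query σ.hist) * σ.llr) else ⊤

open Classical in
/-- The constant `v` as long as the procedure has not stopped. -/
noncomputable def runningCost (D : Procedure) (v : ℝ) (σ : State) : ENNReal :=
  if Stopped D.cls σ.hist then 0 else ENNReal.ofReal v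

lemma measurableSet_valid (h : History) : MeasurableSet {z | Valid D ⟨h, z⟩} := by
  unfold Valid
  by_cases hr : Reachable D h <;> by_cases hs : Stopped D.cls h
  · simp [hr, hs]
  · simp only [hr, hs, true_and, false_or]
    exact measurableSet_Ioo
  · simp [hr]
  · simp [hr]

lemma measurable_costPotential (c : History → Bool → ℝ) (K : ℝ) :
    Measurable (costPotential D S c K) := by
  refine measurable_of_sections fun h => ?_
  unfold costPotential
  refine Measurable.ite (measurableSet_valid h) ?_ measurable_const
  by_cases hs : Stopped D.cls h
  · simp [hs]
  · simp only [hs, if_false]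
    fun_prop

lemma measurable_runningCost (v : ℝ) : Measurable (runningCost D v) := by
  refine measurable_of_sections fun h => ?_
  exact (measurable_const : Measurable fun _ : ℝ => runningCost D v ⟨h, 0⟩)

lemma costPotential_append {c : History → Bool → ℝ} {K : ℝ} {h : History} {b : Bool}
    (hv : Valid D ⟨h ++ [(D.query h, b)], 0⟩) :
    costPotential D S c K ⟨h ++ [(D.query h, b)], 0⟩ = ENNReal.ofReal (K - spent c h - c h b) := by
  rw [costPotential, if_pos hv]
  simp only [spent_append, mul_zero, ite_self, sub_zero, sub_sub]

/-- Wald's identity in one-step form: each measurement consumes ρ²/2 of the budget in mean. No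
hypothesis on the correctness of earlier answers is needed, as `hK` covers every reachable history.
-/
lemma costPotential_step {c : History → Bool → ℝ} {K : ℝ} (hΓ : 0 < Γ) (hμ : 0 < μ)
    (hρ2 : √Γ * μ ≤ 2) (hl : ∀ h, lowerAt D h < 0) (hu : ∀ h, 0 < upperAt D h)
    (hc0 : ∀ h, -lowerAt D h + 2 * (√Γ * μ) ≤ c h false)
    (hc1 : ∀ h, upperAt D h + 2 * (√Γ * μ) ≤ c h true)
    (hK : ∀ h, Reachable D h → spent c h ≤ K) (σ : State) :
    ∫⁻ w, costPotential D S c K (step D μ Γ S σ w) ∂gaussianReal 0 1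
      + runningCost D ((√Γ * μ) ^ 2 / 2) σ ≤ costPotential D S c K σ := by
  by_cases hv : Valid D σ
  swap
  · rw [costPotential.eq_def D S c K σ, if_neg hv]; exact le_top
  by_cases hs : Stopped D.cls σ.hist
  · simp [step_of_stopped D μ Γ S hs, runningCost, hs]
  have hz := hv.2.resolve_left hs
  have hstep := fun w => hv.step μ Γ S hl hu w
  have hnext := fun w => dir_mul_nextLlr (D := D) (μ := μ) (S := S) hΓ σ w
  have hsp0 := hK _ (hv.1.append false hs)
  have hsp1 := hK _ (hv.1.append true hs)
  rw [spent_append] at hsp0 hsp1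
  have hρ : 0 < √Γ * μ := mul_pos (Real.sqrt_pos.2 hΓ) hμ
  have hσ : costPotential D S c K σ = ENNReal.ofReal (K - spent c σ.hist
      - dir S (D.query σ.hist) * σ.llr) := by
    rw [costPotential, if_pos hv, if_neg hs]
  rw [hσ, runningCost, if_neg hs]
  clear hσ
  have hl' := hl σ.hist
  have hu' := hu σ.hist
  have hc0' := hc0 σ.hist
  have hc1' := hc1 σ.hist
  set ρ := √Γ * μ
  set a := K - spent c σ.hist with ha
  set τ := dir S (D.query σ.hist) with hτ
  set ζ := τ * σ.llr with hζ
  -- b is the height of the correct boundary. On crossing it, the charge replaces the walk by at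
  -- least b + 2ρ. At the wrong boundary the signed walk is negative and the charge positive, so the
  -- bound holds without any allowance. The inequality b + 2ρ ≤ a comes from the budget of the
  -- extended history.
  obtain ⟨b, hζb, hba, hbound⟩ : ∃ b : ℝ, ζ < b ∧ b + 2 * ρ ≤ a ∧
      ∀ w, costPotential D S c K (step D μ Γ S σ w) ≤ ENNReal.ofReal
        (a - (ζ + ρ * (τ * w) + ρ ^ 2 / 2) +
          {v | b ≤ ζ + ρ * v + ρ ^ 2 / 2}.indicator
            (fun v => ζ + ρ * v + ρ ^ 2 / 2 - b - 2 * ρ) (τ * w)) := by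
    by_cases hq : D.query σ.hist ∈ S
    · have hτ1 : τ = 1 := by rw [hτ, dir, if_pos hq]
      refine ⟨upperAt D σ.hist, by rw [hζ, hτ1, one_mul]; exact hz.2, by linarith, fun w => ?_⟩
      have hn := hnext w
      have hst := hstep w
      rw [← hn]
      by_cases h1 : nextLlr D μ Γ S σ w ≤ lowerAt D σ.hist
      · rw [step_of_le D μ Γ S hs h1] at hst ⊢
        rw [costPotential_append hst, Set.indicator_of_notMem]
        · refine ENNReal.ofReal_le_ofReal ?_
          rw [hτ1]; linarith
        · rw [Set.mem_ofPred_eq, ← hn, hτ1]; linarith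
      by_cases h2 : upperAt D σ.hist ≤ nextLlr D μ Γ S σ w
      · rw [step_of_ge D μ Γ S hs h1 h2] at hst ⊢
        rw [costPotential_append hst, Set.indicator_of_mem]
        · refine ENNReal.ofReal_le_ofReal ?_
          rw [← hn, hτ1]; linarith
        · rw [Set.mem_ofPred_eq, ← hn, hτ1]; linarith
      · rw [step_of_between D μ Γ S hs h1 h2] at hst ⊢
        rw [costPotential, if_pos hst, if_neg hs, Set.indicator_of_notMem, add_zero]
        rw [Set.mem_ofPred_eq, ← hn, hτ1]; linarith
    · have hτ1 : τ = -1 := by rw [hτ, dir, if_neg hq]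
      refine ⟨-lowerAt D σ.hist, by rw [hζ, hτ1]; linarith [hz.1], by linarith, fun w => ?_⟩
      have hn := hnext w
      have hst := hstep w
      rw [← hn]
      by_cases h1 : nextLlr D μ Γ S σ w ≤ lowerAt D σ.hist
      · rw [step_of_le D μ Γ S hs h1] at hst ⊢
        rw [costPotential_append hst, Set.indicator_of_mem]
        · refine ENNReal.ofReal_le_ofReal ?_
          rw [← hn, hτ1]; linarith
        · rw [Set.mem_ofPred_eq, ← hn, hτ1]; linarith
      by_cases h2 : upperAt D σ.hist ≤ nextLlr D μ Γ S σ w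
      · rw [step_of_ge D μ Γ S hs h1 h2] at hst ⊢
        rw [costPotential_append hst, Set.indicator_of_notMem]
        · refine ENNReal.ofReal_le_ofReal ?_
          rw [hτ1]; linarith
        · rw [Set.mem_ofPred_eq, ← hn, hτ1]; linarith
      · rw [step_of_between D μ Γ S hs h1 h2] at hst ⊢
        rw [costPotential, if_pos hst, if_neg hs, Set.indicator_of_notMem, add_zero]
        rw [Set.mem_ofPred_eq, ← hn, hτ1]; linarith
  obtain ⟨hint, hle⟩ := integral_walk_le a hρ hρ2 hζb
  set g : ℝ → ℝ := fun v => a - (ζ + ρ * v + ρ ^ 2 / 2) +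
    {v | b ≤ ζ + ρ * v + ρ ^ 2 / 2}.indicator
      (fun v => ζ + ρ * v + ρ ^ 2 / 2 - b - 2 * ρ) v with hg
  -- Beyond b the value is the constant a - b - 2ρ, and before b it exceeds a - b. Nonnegativity is
  -- what lets the real integral replace the lower integral.
  have hg0 : ∀ v, 0 ≤ g v := by
    intro v
    by_cases hv : b ≤ ζ + ρ * v + ρ ^ 2 / 2
    · rw [hg]
      simp only
      rw [Set.indicator_of_mem (by exact hv)]
      linarith
    · rw [hg]
      simp only
      rw [Set.indicator_of_notMem (by exact hv)]
      linarith
  have hgm : Measurable g := by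
    refine Measurable.add (by fun_prop) (Measurable.indicator (by fun_prop) ?_)
    exact measurableSet_le measurable_const (by fun_prop)
  calc ∫⁻ w, costPotential D S c K (step D μ Γ S σ w) ∂gaussianReal 0 1
        + ENNReal.ofReal (ρ ^ 2 / 2)
      ≤ ∫⁻ w, ENNReal.ofReal (g (τ * w)) ∂gaussianReal 0 1 + ENNReal.ofReal (ρ ^ 2 / 2) := by
        gcongr with w
        exact hbound w
    _ = ENNReal.ofReal (∫ v, g v ∂gaussianReal 0 1) + ENNReal.ofReal (ρ ^ 2 / 2) := by
        rw [lintegral_sign_mul_gaussianReal (dir_eq _ _) (fun v => ENNReal.ofReal (g v))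
          (ENNReal.measurable_ofReal.comp hgm),
          ofReal_integral_eq_lintegral_ofReal hint (Filter.Eventually.of_forall hg0)]
    _ = ENNReal.ofReal (∫ v, g v ∂gaussianReal 0 1 + ρ ^ 2 / 2) :=
        (ENNReal.ofReal_add (integral_nonneg hg0) (by positivity)).symm
    _ ≤ ENNReal.ofReal (a - ζ) := ENNReal.ofReal_le_ofReal (by linarith)

variable {Ω : Type*} [MeasurableSpace Ω] {P : Measure Ω}
  {W : ℕ → Ω → ℝ}

lemma measurable_precision (D : Procedure) (μ Γ : ℝ) (S : Finset ℕ) (hW : IsStdNormalNoise P W)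
    (j : ℕ) : Measurable fun ω => precision D μ Γ S (fun i => W i ω) j := by
  unfold precision
  exact Measurable.ite (measurable_run_noise μ Γ S D hW j
    (measurable_hist_pred fun h => Stopped D.cls h)) measurable_const measurable_const

/-- Since Γ = (2/μ²)(ρ²/2), the precision is 2/μ² times the accumulated drift, which the initial
potential K bounds. -/
theorem lintegral_precision_le [IsProbabilityMeasure P] {c : History → Bool → ℝ} {K : ℝ} (hW : IsStdNormalNoise P W)
    (hΓ : 0 < Γ) (hμ : 0 < μ)
    (hρ2 : √Γ * μ ≤ 2) (hl : ∀ h, lowerAt D h < 0) (hu : ∀ h, 0 < upperAt D h)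
    (hc0 : ∀ h, -lowerAt D h + 2 * (√Γ * μ) ≤ c h false)
    (hc1 : ∀ h, upperAt D h + 2 * (√Γ * μ) ≤ c h true)
    (hK : ∀ h, Reachable D h → spent c h ≤ K) (S : Finset ℕ) :
    ∫⁻ ω, ∑' j, ENNReal.ofReal (precision D μ Γ S (fun i => W i ω) j) ∂P
      ≤ ENNReal.ofReal (2 * K / μ ^ 2) := by
  have hprec : ∀ ω j, ENNReal.ofReal (precision D μ Γ S (fun i => W i ω) j)
      = ENNReal.ofReal (2 / μ ^ 2)
        * runningCost D ((√Γ * μ) ^ 2 / 2) (run D μ Γ S (fun i => W i ω) j) := by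
    intro ω j
    unfold precision runningCost
    split_ifs
    · simp
    · rw [← ENNReal.ofReal_mul (by positivity), mul_pow, Real.sq_sqrt hΓ.le]
      congr 1
      field_simp
  rw [lintegral_tsum fun j => (measurable_precision D μ Γ S hW j).ennreal_ofReal.aemeasurable]
  refine ENNReal.tsum_le_of_sum_range_le fun J => ?_
  have hmain := sum_lintegral_add_le μ Γ S D hW (measurable_costPotential (D := D) (S := S) c K)
    (measurable_runningCost _) (costPotential_step hΓ hμ hρ2 hl hu hc0 hc1 hK) J
  have hinit : costPotential D S c K ⟨[], 0⟩ = ENNReal.ofReal K := by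
    rw [costPotential, if_pos ⟨.nil, Or.inr ⟨hl _, hu _⟩⟩]
    simp
  rw [hinit] at hmain
  calc ∑ j ∈ Finset.range J, ∫⁻ ω, ENNReal.ofReal (precision D μ Γ S (fun i => W i ω) j) ∂P
      = ENNReal.ofReal (2 / μ ^ 2) * ∑ j ∈ Finset.range J,
          ∫⁻ ω, runningCost D ((√Γ * μ) ^ 2 / 2) (run D μ Γ S (fun i => W i ω) j) ∂P := by
        rw [Finset.mul_sum]
        refine Finset.sum_congr rfl fun j _ => ?_
        simp only [hprec]
        exact lintegral_const_mul _
          ((measurable_runningCost _).comp (measurable_run_noise μ Γ S D hW j))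
    _ ≤ ENNReal.ofReal (2 / μ ^ 2) * ENNReal.ofReal K := by
        gcongr
        exact le_self_add.trans hmain
    _ = ENNReal.ofReal (2 * K / μ ^ 2) := by
        rw [← ENNReal.ofReal_mul (by positivity)]
        congr 1
        ring

/-! ### The error probability -/

/-- The probability bound for a wrong answer, as a function of the correct answer. -/
noncomputable def errorBound (D : Procedure) (h : History) (b : Bool) : ℝ :=
  Real.exp (if b then lowerAt D h else -upperAt D h)

open Classical in
/-- A bound for the probability that an answer is or becomes wrong. -/
noncomputable def errorPotential (D : Procedure) (S : Finset ℕ) (δ : ℝ) (σ : State) : ENNReal :=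
  if ¬ Valid D σ then ⊤ else if ¬ Correct S σ.hist then 1 else
    ENNReal.ofReal (δ - spent (errorBound D) σ.hist - if Stopped D.cls σ.hist then 0 else
      errorBound D σ.hist (decide (D.query σ.hist ∈ S))
        * (1 - Real.exp (-(dir S (D.query σ.hist) * σ.llr))))

lemma measurable_errorPotential (δ : ℝ) : Measurable (errorPotential D S δ) := by
  refine measurable_of_sections fun h => ?_
  unfold errorPotential
  refine Measurable.ite (measurableSet_valid h).compl measurable_const ?_
  by_cases hc : Correct S h
  · simp only [hc, not_true_eq_false, if_false]
    by_cases hs : Stopped D.cls h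
    · simp [hs]
    · simp only [hs, if_false]
      have (e : ℝ) : Measurable fun z : ℝ => ENNReal.ofReal
          (δ - spent (errorBound D) h - e * (1 - Real.exp (-(dir S (D.query h) * z)))) := by
        fun_prop
      exact this (errorBound D h (decide (D.query h ∈ S)))
  · simp [hc]

lemma errorPotential_append_le {δ : ℝ} {h : History} {b : Bool}
    (hv : Valid D ⟨h ++ [(D.query h, b)], 0⟩) (hb : b = decide (D.query h ∈ S))
    (hc : Correct S h) :
    errorPotential D S δ ⟨h ++ [(D.query h, b)], 0⟩
      = ENNReal.ofReal (δ - spent (errorBound D) h - errorBound D h b) := by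
  have hc' : Correct S (h ++ [(D.query h, b)]) := correct_append.2 ⟨hc, by simp [hb]⟩
  rw [errorPotential, if_neg (not_not.2 hv), if_neg (not_not.2 hc')]
  simp only [spent_append, mul_zero, neg_zero, Real.exp_zero, sub_self, ite_self, sub_zero,
    sub_sub]

lemma errorPotential_of_wrong {δ : ℝ} {σ : State} (hv : Valid D σ) (hc : ¬ Correct S σ.hist) :
    errorPotential D S δ σ = 1 := by
  rw [errorPotential, if_neg (not_not.2 hv), if_pos hc]

lemma Correct.of_step {σ : State} {w : ℝ} (h : Correct S (step D μ Γ S σ w).hist) :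
    Correct S σ.hist := by
  by_cases hs : Stopped D.cls σ.hist
  · rwa [step_of_stopped D μ Γ S hs] at h
  by_cases h1 : nextLlr D μ Γ S σ w ≤ lowerAt D σ.hist
  · rw [step_of_le D μ Γ S hs h1] at h
    exact (correct_append.1 h).1
  by_cases h2 : upperAt D σ.hist ≤ nextLlr D μ Γ S σ w
  · rw [step_of_ge D μ Γ S hs h1 h2] at h
    exact (correct_append.1 h).1
  · rwa [step_of_between D μ Γ S hs h1 h2] at h

/-- While all answers are right, the potential is affine in the martingale exp(-walk) with
nonnegative coefficients. A wrong answer makes it the absorbing value 1, which the affine expression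
already dominates at the wrong boundary. -/
lemma errorPotential_step {δ : ℝ} (hΓ : 0 < Γ)
    (hl : ∀ h, lowerAt D h < 0) (hu : ∀ h, 0 < upperAt D h)
    (hδ : ∀ h, Reachable D h → spent (errorBound D) h ≤ δ) (σ : State) :
    ∫⁻ w, errorPotential D S δ (step D μ Γ S σ w) ∂gaussianReal 0 1
      ≤ errorPotential D S δ σ := by
  by_cases hv : Valid D σ
  swap
  · rw [errorPotential.eq_def D S δ σ, if_pos hv]; exact le_top
  by_cases hs : Stopped D.cls σ.hist
  · simp [step_of_stopped D μ Γ S hs]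
  have hstep := fun w => hv.step μ Γ S hl hu w
  by_cases hc : Correct S σ.hist
  swap
  · rw [errorPotential_of_wrong hv hc]
    simp only [errorPotential_of_wrong (hstep _) fun h => hc h.of_step]
    simp
  have hnext := fun w => dir_mul_nextLlr (D := D) (μ := μ) (S := S) hΓ σ w
  have hsp := hδ _ (hv.1.append (decide (D.query σ.hist ∈ S)) hs)
  rw [spent_append] at hsp
  have hσ : errorPotential D S δ σ = ENNReal.ofReal (δ - spent (errorBound D) σ.hist
      - errorBound D σ.hist (decide (D.query σ.hist ∈ S))
      + errorBound D σ.hist (decide (D.query σ.hist ∈ S))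
        * Real.exp (-(dir S (D.query σ.hist) * σ.llr))) := by
    rw [errorPotential, if_neg (not_not.2 hv), if_neg (not_not.2 hc), if_neg hs]
    congr 1
    ring
  rw [hσ]
  clear hσ
  have he0 : 0 ≤ errorBound D σ.hist (decide (D.query σ.hist ∈ S)) := (Real.exp_pos _).le
  set e := errorBound D σ.hist (decide (D.query σ.hist ∈ S)) with he
  set a := δ - spent (errorBound D) σ.hist - e with ha
  set τ := dir S (D.query σ.hist) with hτ
  have ha0 : 0 ≤ a := by
    rw [ha]; linarith
  have hbound : ∀ w, errorPotential D S δ (step D μ Γ S σ w) ≤ ENNReal.ofReal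
      (a + e * Real.exp (-(τ * nextLlr D μ Γ S σ w))) := by
    intro w
    have hst := hstep w
    have hpos : 0 ≤ e * Real.exp (-(τ * nextLlr D μ Γ S σ w)) :=
      mul_nonneg he0 (Real.exp_pos _).le
    by_cases h1 : nextLlr D μ Γ S σ w ≤ lowerAt D σ.hist
    · rw [step_of_le D μ Γ S hs h1] at hst ⊢
      by_cases hq : D.query σ.hist ∈ S
      · rw [errorPotential_of_wrong hst (fun h => by simpa [hq] using (correct_append.1 h).2),
          ← ENNReal.ofReal_one]
        refine ENNReal.ofReal_le_ofReal ?_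
        -- Here e = exp(l), and the walk is at or below l; overshoot only helps.
        have : 1 ≤ e * Real.exp (-(τ * nextLlr D μ Γ S σ w)) := by
          rw [he, errorBound, ← Real.exp_add, Real.one_le_exp_iff, hτ, dir, if_pos hq]
          simp only [hq, decide_true, if_true]
          linarith
        linarith
      · rw [errorPotential_append_le hst (by simp [hq]) hc]
        refine ENNReal.ofReal_le_ofReal ?_
        have : errorBound D σ.hist false = e := by rw [he]; simp [hq]
        rw [this]; linarith
    by_cases h2 : upperAt D σ.hist ≤ nextLlr D μ Γ S σ w
    · rw [step_of_ge D μ Γ S hs h1 h2] at hst ⊢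
      by_cases hq : D.query σ.hist ∈ S
      · rw [errorPotential_append_le hst (by simp [hq]) hc]
        refine ENNReal.ofReal_le_ofReal ?_
        have : errorBound D σ.hist true = e := by rw [he]; simp [hq]
        rw [this]; linarith
      · rw [errorPotential_of_wrong hst (fun h => by simpa [hq] using (correct_append.1 h).2),
          ← ENNReal.ofReal_one]
        refine ENNReal.ofReal_le_ofReal ?_
        have : 1 ≤ e * Real.exp (-(τ * nextLlr D μ Γ S σ w)) := by
          rw [he, errorBound, ← Real.exp_add, Real.one_le_exp_iff, hτ, dir, if_neg hq]
          simp only [hq, decide_false, Bool.false_eq_true, if_false]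
          linarith
        linarith
    · rw [step_of_between D μ Γ S hs h1 h2] at hst ⊢
      rw [errorPotential, if_neg (not_not.2 hst), if_neg (not_not.2 hc), if_neg hs]
      refine ENNReal.ofReal_le_ofReal (le_of_eq ?_)
      simp only [← he, ← hτ, ha]
      ring
  refine (lintegral_mono hbound).trans (le_of_eq ?_)
  simp only [hnext]
  rw [lintegral_sign_mul_gaussianReal (dir_eq _ _) (fun v => ENNReal.ofReal
    (a + e * Real.exp (-(τ * σ.llr + √Γ * μ * v + (√Γ * μ) ^ 2 / 2)))) (by fun_prop),
    lintegral_exp_neg_walk a e _ _ ha0 he0]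

lemma valid_run (hl : ∀ h, lowerAt D h < 0) (hu : ∀ h, 0 < upperAt D h) (w : ℕ → ℝ) (j : ℕ) :
    Valid D (run D μ Γ S w j) := by
  induction j with
  | zero => exact ⟨.nil, Or.inr ⟨hl _, hu _⟩⟩
  | succ j ih => exact ih.step μ Γ S hl hu (w j)

lemma measure_wrong_le [IsProbabilityMeasure P] {δ : ℝ} (hW : IsStdNormalNoise P W) (hΓ : 0 < Γ)
    (hl : ∀ h, lowerAt D h < 0) (hu : ∀ h, 0 < upperAt D h)
    (hδ : ∀ h, Reachable D h → spent (errorBound D) h ≤ δ) (j : ℕ) :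
    P {ω | ¬ Correct S (run D μ Γ S (fun i => W i ω) j).hist} ≤ ENNReal.ofReal δ := by
  have hmain := sum_lintegral_add_le μ Γ S D hW (measurable_errorPotential (D := D) (S := S) δ)
    (measurable_const (a := (0 : ENNReal)))
    (fun σ => by rw [add_zero]; exact errorPotential_step hΓ hl hu hδ σ) j
  have hinit : errorPotential D S δ ⟨[], 0⟩ = ENNReal.ofReal δ := by
    have hv : Valid D ⟨[], 0⟩ := ⟨.nil, Or.inr ⟨hl _, hu _⟩⟩
    have hc : Correct S [] := by simp [Correct]
    rw [errorPotential, if_neg (not_not.2 hv), if_neg (not_not.2 hc)]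
    simp
  rw [hinit] at hmain
  have hm : MeasurableSet {ω | ¬ Correct S (run D μ Γ S (fun i => W i ω) j).hist} :=
    measurable_run_noise μ Γ S D hW j (measurable_hist_pred fun h => ¬ Correct S h)
  calc P {ω | ¬ Correct S (run D μ Γ S (fun i => W i ω) j).hist}
      = ∫⁻ ω, {ω | ¬ Correct S (run D μ Γ S (fun i => W i ω) j).hist}.indicator 1 ω ∂P :=
        (lintegral_indicator_one hm).symm
    _ ≤ ∫⁻ ω, errorPotential D S δ (run D μ Γ S (fun i => W i ω) j) ∂P := by
        refine lintegral_mono fun ω => ?_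
        by_cases hω : Correct S (run D μ Γ S (fun i => W i ω) j).hist
        · rw [Set.indicator_of_notMem (by simpa using hω)]
          exact zero_le
        · rw [Set.indicator_of_mem (by exact hω), errorPotential_of_wrong (valid_run hl hu _ _) hω]
          rfl
    _ ≤ ENNReal.ofReal δ := le_add_self.trans hmain

lemma estimate_eq_of_correct {C : Set (Finset ℕ)} (hS : S ∈ C) {h : History}
    (hs : Stopped C h) (hc : Correct S h) : estimate C h = S := by
  have hex : ∃! S', Consistent C h S' := ⟨S, ⟨hS, hc⟩, fun S' hS' => hs.2 _ _ hS' ⟨hS, hc⟩⟩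
  rw [estimate, dif_pos hex]
  exact hs.2 _ _ hex.choose_spec.1 ⟨hS, hc⟩

/-- Finite expected precision forces almost sure stopping, because every measurement costs the same
Γ > 0. Wrong answers are never erased, so the bound at each fixed time passes to the union by
continuity from below. -/
theorem measure_estimator_ne_le [IsProbabilityMeasure P] {δ : ℝ} (hW : IsStdNormalNoise P W) (hΓ : 0 < Γ)
    (hl : ∀ h, lowerAt D h < 0) (hu : ∀ h, 0 < upperAt D h)
    (hδ : ∀ h, Reachable D h → spent (errorBound D) h ≤ δ) (hS : S ∈ D.cls)
    (hfin : ∫⁻ ω, ∑' j, ENNReal.ofReal (precision D μ Γ S (fun i => W i ω) j) ∂P ≠ ⊤) :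
    P {ω | estimator D μ Γ S (fun j => W j ω) ≠ S} ≤ ENNReal.ofReal δ := by
  set N : Set Ω := {ω | ¬ ∃ j, Stopped D.cls (run D μ Γ S (fun i => W i ω) j).hist} with hN
  set B : ℕ → Set Ω := fun j => {ω | ¬ Correct S (run D μ Γ S (fun i => W i ω) j).hist} with hB
  have hN0 : P N = 0 := by
    have hae := ae_lt_top' (AEMeasurable.tsum fun j =>
      (measurable_precision D μ Γ S hW j).ennreal_ofReal.aemeasurable) hfin
    refine measure_mono_null (fun ω hω => ?_) (ae_iff.1 hae)
    have : ∀ j, ENNReal.ofReal (precision D μ Γ S (fun i => W i ω) j) = ENNReal.ofReal Γ := by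
      intro j
      rw [precision, if_neg fun h => hω ⟨j, h⟩]
    simp only [Set.mem_ofPred_eq, this, not_lt, top_le_iff]
    exact ENNReal.tsum_const_eq_top_of_ne_zero (by simpa using hΓ)
  have hmono : Monotone B :=
    monotone_nat_of_le_succ fun j ω hω hc => hω (Correct.of_step hc)
  have hsub : {ω | estimator D μ Γ S (fun j => W j ω) ≠ S} ⊆ N ∪ ⋃ j, B j := by
    intro ω hω
    by_contra hcon
    rw [Set.mem_union, not_or, Set.mem_iUnion, not_exists] at hcon
    have hT : ∃ j, Stopped D.cls (run D μ Γ S (fun i => W i ω) j).hist := not_not.1 hcon.1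
    refine hω ?_
    rw [estimator, dif_pos hT]
    classical
    exact estimate_eq_of_correct hS (Nat.find_spec hT) (not_not.1 (hcon.2 _))
  calc P {ω | estimator D μ Γ S (fun j => W j ω) ≠ S}
      ≤ P N + P (⋃ j, B j) := (measure_mono hsub).trans (measure_union_le _ _)
    _ = ⨆ j, P (B j) := by rw [hN0, zero_add, hmono.measure_iUnion]
    _ ≤ ENNReal.ofReal δ := iSup_le fun j => measure_wrong_le hW hΓ hl hu hδ j

end Guarantees

/-! ### Unions of disjoint intervals and the grid -/

lemma exists_grid_mem {s a : ℕ} (hs : 1 ≤ s) (ha : 1 ≤ a) :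
    ∃ i, a ≤ i * s + 1 ∧ i * s + 1 < a + s := by
  -- The quotient (a - 1)/s rounded up.
  refine ⟨(a - 1 + (s - 1)) / s, ?_⟩
  have h1 := Nat.div_add_mod (a - 1 + (s - 1)) s
  have h2 := Nat.mod_lt (a - 1 + (s - 1)) (by omega : s > 0)
  rw [mul_comm] at h1
  omega

lemma grid_unique {s a i i' : ℕ} (h1 : a ≤ i * s + 1) (h2 : i * s + 1 < a + s)
    (h1' : a ≤ i' * s + 1) (h2' : i' * s + 1 < a + s) : i = i' := by
  rcases lt_trichotomy i i' with h | h | h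
  · have := Nat.mul_le_mul_right s (Nat.succ_le_of_lt h)
    rw [Nat.succ_mul] at this
    omega
  · exact h
  · have := Nat.mul_le_mul_right s (Nat.succ_le_of_lt h)
    rw [Nat.succ_mul] at this
    omega

lemma exists_starts {n s k : ℕ} {S : Finset ℕ} (hS : S ∈ unionsOfIntervals n s k) :
    ∃ a : Fin k → ℕ, (∀ i, 1 ≤ a i ∧ a i + s ≤ n + 1) ∧
      (∀ i j, i ≠ j → Disjoint (Finset.Ico (a i) (a i + s)) (Finset.Ico (a j) (a j + s))) ∧
      S = Finset.univ.biUnion fun i => Finset.Ico (a i) (a i + s) := by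
  obtain ⟨I, hI, hd, rfl⟩ := hS
  choose a ha using hI
  refine ⟨a, fun i => ⟨(ha i).1, (ha i).2.1⟩, fun i j hij => ?_, ?_⟩
  · rw [← (ha i).2.2, ← (ha j).2.2]
    exact hd i j hij
  · exact congrArg _ (funext fun i => (ha i).2.2)

lemma mul_le_of_mem_unionsOfIntervals {n s k : ℕ} {S : Finset ℕ}
    (hS : S ∈ unionsOfIntervals n s k) : k * s ≤ n := by
  obtain ⟨a, ha, hd, rfl⟩ := exists_starts hS
  have hc : (Finset.univ.biUnion fun i => Finset.Ico (a i) (a i + s)).card = k * s := by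
    rw [Finset.card_biUnion fun i _ j _ hij => hd i j hij]
    simp
  have hsub : (Finset.univ.biUnion fun i => Finset.Ico (a i) (a i + s)) ⊆ Finset.Icc 1 n := by
    intro x hx
    simp only [Finset.mem_biUnion, Finset.mem_univ, true_and, Finset.mem_Ico] at hx
    obtain ⟨i, hi⟩ := hx
    have := ha i
    rw [Finset.mem_Icc]
    omega
  have := Finset.card_le_card hsub
  rwa [hc, Nat.card_Icc, Nat.add_sub_cancel] at this

/-- The grid points of a union of `k` disjoint intervals, one in each interval. -/
lemma exists_grid_points {s k : ℕ} (hs : 1 ≤ s) {a : Fin k → ℕ} (ha : ∀ i, 1 ≤ a i)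
    (hd : ∀ i j, i ≠ j → Disjoint (Finset.Ico (a i) (a i + s)) (Finset.Ico (a j) (a j + s))) :
    ∃ f : Fin k → ℕ, (∀ i, f i * s + 1 ∈ Finset.Ico (a i) (a i + s)) ∧
      Function.Injective fun i => f i * s + 1 := by
  choose f hf using fun i => exists_grid_mem hs (ha i)
  refine ⟨f, fun i => Finset.mem_Ico.2 (hf i), fun i j hij => ?_⟩
  by_contra hne
  refine Finset.disjoint_left.1 (hd i j hne) (Finset.mem_Ico.2 (hf i)) ?_
  simp only at hij
  rw [hij]
  exact Finset.mem_Ico.2 (hf j)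

/-- An interval missing x lies entirely on one side of it and contributes 0 or s points. -/
lemma dvd_card_filter_lt {s a x : ℕ} (hx : x ∉ Finset.Ico a (a + s)) :
    s ∣ ((Finset.Ico a (a + s)).filter (· < x)).card := by
  rw [Finset.mem_Ico, not_and_or, not_le, not_lt] at hx
  rcases hx with hx | hx
  · rw [Finset.filter_false_of_mem]
    · simp
    · intro y hy
      rw [Finset.mem_Ico] at hy
      omega
  · rw [Finset.filter_true_of_mem]
    · simp
    · intro y hy
      rw [Finset.mem_Ico] at hy
      omega

lemma card_filter_lt_biUnion {s k : ℕ} {a : Fin k → ℕ}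
    (hd : ∀ i j, i ≠ j → Disjoint (Finset.Ico (a i) (a i + s)) (Finset.Ico (a j) (a j + s)))
    (x : ℕ) :
    ((Finset.univ.biUnion fun i => Finset.Ico (a i) (a i + s)).filter (· < x)).card
      = ∑ i, ((Finset.Ico (a i) (a i + s)).filter (· < x)).card := by
  rw [Finset.filter_biUnion, Finset.card_biUnion]
  intro i _ j _ hij
  exact Finset.disjoint_filter_filter (hd i j hij)

/-- The first point in which two unions of disjoint intervals differ is the left end of an
interval. -/
lemma start_of_first_difference {n s k x : ℕ} {S₂ : Finset ℕ} {a : Fin k → ℕ}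
    (hd : ∀ i j, i ≠ j → Disjoint (Finset.Ico (a i) (a i + s)) (Finset.Ico (a j) (a j + s)))
    (hS₂ : S₂ ∈ unionsOfIntervals n s k) (hx₂ : x ∉ S₂)
    (hlt : ∀ y < x, y ∈ (Finset.univ.biUnion fun i => Finset.Ico (a i) (a i + s)) ↔ y ∈ S₂)
    {i : Fin k} (hi : x ∈ Finset.Ico (a i) (a i + s)) : x = a i := by
  have h₂ : s ∣ (S₂.filter (· < x)).card := by
    obtain ⟨a₂, -, hd₂, rfl⟩ := exists_starts hS₂
    rw [card_filter_lt_biUnion hd₂]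
    exact Finset.dvd_sum fun j _ => dvd_card_filter_lt fun hj => hx₂ <| Finset.mem_biUnion.2
      ⟨j, Finset.mem_univ _, hj⟩
  have he : (Finset.univ.biUnion fun i => Finset.Ico (a i) (a i + s)).filter (· < x)
      = S₂.filter (· < x) := by
    ext y
    simp only [Finset.mem_filter]
    constructor
    · exact fun h => ⟨(hlt y h.2).1 h.1, h.2⟩
    · exact fun h => ⟨(hlt y h.2).2 h.1, h.2⟩
  rw [← he, card_filter_lt_biUnion hd, ← Finset.add_sum_erase _ _ (Finset.mem_univ i)] at h₂
  have hrest : s ∣ ∑ j ∈ Finset.univ.erase i, ((Finset.Ico (a j) (a j + s)).filter (· < x)).card :=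
    Finset.dvd_sum fun j hj => dvd_card_filter_lt fun hxj =>
      Finset.disjoint_left.1 (hd i j (Finset.ne_of_mem_erase hj).symm) hi hxj
  -- The interval of x alone contributes x - a i < s points below x, a multiple of s, hence none.
  have hdvd := (Nat.dvd_add_iff_left hrest).2 h₂
  rw [Finset.mem_Ico] at hi
  have hfe : (Finset.Ico (a i) (a i + s)).filter (· < x) = Finset.Ico (a i) x := by
    ext y
    simp only [Finset.mem_filter, Finset.mem_Ico]
    omega
  rw [hfe, Nat.card_Ico] at hdvd
  have := Nat.eq_zero_of_dvd_of_lt hdvd (by omega)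
  omega

/-! ### Histories of the two-phase procedure -/

lemma hits_append (h h' : History) : hits (h ++ h') = hits h ++ hits h' := by
  simp [hits]

lemma mem_hits {h : History} {c : ℕ} : c ∈ hits h ↔ (c, true) ∈ h := by
  simp [hits]

lemma length_hits_le (h : History) : (hits h).length ≤ h.length := by
  simpa [hits] using List.length_filter_le _ h

lemma hits_sublist (h : History) : (hits h).Sublist (h.map Prod.fst) :=
  (List.filter_sublist).map _

/-- The queries in `h` are the first grid points. -/
def GridQueries (s : ℕ) (h : History) : Prop :=
  h.map Prod.fst = (List.range h.length).map fun i => i * s + 1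

lemma GridQueries.append {s : ℕ} {h : History} (hg : GridQueries s h) (b : Bool) :
    GridQueries s (h ++ [(h.length * s + 1, b)]) := by
  unfold GridQueries at *
  simp [List.range_succ, hg]

lemma GridQueries.nodup {s : ℕ} (hs : 1 ≤ s) {h : History} (hg : GridQueries s h) :
    (hits h).Nodup := by
  refine (hits_sublist h).nodup ?_
  rw [hg]
  refine List.Nodup.map ?_ List.nodup_range
  intro i j hij
  exact Nat.eq_of_mul_eq_mul_right hs (Nat.succ_injective hij)

lemma GridQueries.exists_of_mem {s : ℕ} {h : History} (hg : GridQueries s h) {c : ℕ}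
    (hc : c ∈ hits h) : ∃ i, c = i * s + 1 := by
  have := (hits_sublist h).subset hc
  rw [hg, List.mem_map] at this
  obtain ⟨i, -, hi⟩ := this
  exact ⟨i, hi.symm⟩

/-- A consistent support has k distinct grid points, one per interval. Had all grid points up to n
been queried, these would be k hits. -/
lemma next_grid_le {n s k : ℕ} (hs : 1 ≤ s) {h : History} (hg : GridQueries s h)
    (hh : (hits h).length < k) {S : Finset ℕ} (hS : Consistent (unionsOfIntervals n s k) h S) :
    h.length * s + 1 ≤ n := by
  by_contra hlt
  obtain ⟨a, ha, hd, rfl⟩ := exists_starts hS.1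
  obtain ⟨f, hf, hinj⟩ := exists_grid_points hs (fun i => (ha i).1) hd
  have hmem : ∀ i, f i * s + 1 ∈ (hits h).toFinset := by
    intro i
    have hfi := Finset.mem_Ico.1 (hf i)
    have hai := ha i
    have hlt' : f i < h.length := by
      by_contra hge
      have := Nat.mul_le_mul_right s (not_lt.1 hge)
      omega
    have : f i * s + 1 ∈ h.map Prod.fst := by
      rw [hg]
      exact List.mem_map.2 ⟨f i, List.mem_range.2 hlt', rfl⟩
    obtain ⟨⟨c, b⟩, hp, hc⟩ := List.mem_map.1 this
    simp only at hc
    subst hc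
    have hb : b = true := (hS.2 _ hp).2 (Finset.mem_biUnion.2 ⟨i, Finset.mem_univ _, hf i⟩)
    subst hb
    rw [List.mem_toFinset, mem_hits]
    exact hp
  have h1 : (Finset.univ.image fun i => f i * s + 1) ⊆ (hits h).toFinset := by
    intro c hc
    obtain ⟨i, -, rfl⟩ := Finset.mem_image.1 hc
    exact hmem i
  have h2 := Finset.card_le_card h1
  rw [Finset.card_image_of_injective _ hinj, Finset.card_univ, Fintype.card_fin] at h2
  have h3 := List.toFinset_card_le (hits h)
  omega

/-- If `k` grid points are known to be in the support, then these are all its grid points. -/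
lemma grid_point_mem {s k : ℕ} {a f : Fin k → ℕ}
    (hf : ∀ i, f i * s + 1 ∈ Finset.Ico (a i) (a i + s)) {G : List ℕ} (hG : G.Nodup)
    (hGk : G.length = k) (hGg : ∀ g ∈ G, ∃ i, g = i * s + 1)
    (hGS : ∀ g ∈ G, g ∈ Finset.univ.biUnion fun i => Finset.Ico (a i) (a i + s)) (i : Fin k) :
    f i * s + 1 ∈ G := by
  have hsub : G.toFinset ⊆ Finset.univ.image fun i => f i * s + 1 := by
    intro g hg
    rw [List.mem_toFinset] at hg
    obtain ⟨t, rfl⟩ := hGg g hg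
    obtain ⟨j, -, hj⟩ := Finset.mem_biUnion.1 (hGS _ hg)
    have h1 := Finset.mem_Ico.1 hj
    have h2 := Finset.mem_Ico.1 (hf j)
    rw [grid_unique h1.1 h1.2 h2.1 h2.2]
    exact Finset.mem_image_of_mem _ (Finset.mem_univ j)
  have hcard : (Finset.univ.image fun i => f i * s + 1).card ≤ G.toFinset.card := by
    rw [List.toFinset_card_of_nodup hG, hGk]
    exact Finset.card_image_le.trans (by simp)
  have := Finset.eq_of_subset_of_card_le hsub hcard
  rw [← List.mem_toFinset, this]
  exact Finset.mem_image_of_mem _ (Finset.mem_univ i)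

/-- The first difference x is the left end of an interval of S₁, whose grid point g must be among
the k hits. With no candidate left, the walk from g has reached x with answers 1 only, so x lies in
S₂ as well. -/
lemma first_difference_false {n s k : ℕ} (hs : 1 ≤ s) {h : History}
    (hG : ((hits h).take k).Nodup) (hGk : ((hits h).take k).length = k)
    (hGg : ∀ g ∈ (hits h).take k, ∃ i, g = i * s + 1)
    (hcand : refinementCandidates s k h = ∅) {S₁ S₂ : Finset ℕ}
    (h₁ : Consistent (unionsOfIntervals n s k) h S₁)
    (h₂ : Consistent (unionsOfIntervals n s k) h S₂) {x : ℕ} (hx₁ : x ∈ S₁) (hx₂ : x ∉ S₂)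
    (hlt : ∀ y < x, y ∈ S₁ ↔ y ∈ S₂) : False := by
  obtain ⟨a, ha, hd, hS₁⟩ := exists_starts h₁.1
  obtain ⟨f, hf, -⟩ := exists_grid_points hs (fun i => (ha i).1) hd
  have htake : ∀ g ∈ (hits h).take k, (g, true) ∈ h := fun g hg =>
    mem_hits.1 (List.mem_of_mem_take hg)
  have hgrid := grid_point_mem hf hG hGk hGg
    (fun g hg => hS₁ ▸ (h₁.2 _ (htake g hg)).1 rfl)
  obtain ⟨i, -, hi⟩ := Finset.mem_biUnion.1 (hS₁ ▸ hx₁)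
  have hxa : x = a i := start_of_first_difference hd h₂.1 hx₂ (hS₁ ▸ hlt) hi
  have hsub : ∀ y ∈ Finset.Ico (a i) (a i + s), y ∈ S₁ := fun y hy =>
    hS₁ ▸ Finset.mem_biUnion.2 ⟨i, Finset.mem_univ _, hy⟩
  have hg := hgrid i
  have hfi := Finset.mem_Ico.1 (hf i)
  set g := f i * s + 1
  have hai := (ha i).1
  -- Induction on the distance to g: if everything between j and g is recorded as signal, then j is
  -- a candidate unless already queried, and consistency with S₁ forces the answer 1.
  have htrue : ∀ d j, j + d = g → x ≤ j → (j, true) ∈ h := by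
    intro d
    induction d using Nat.strong_induction_on with
    | _ d ih =>
      intro j hj hxj
      rcases Nat.eq_zero_or_pos d with rfl | hd0
      · have : j = g := by omega
        rw [this]
        exact htake g hg
      · have hnc : j ∉ refinementCandidates s k h := by rw [hcand]; exact Set.notMem_empty _
        by_contra hjh
        refine hnc ⟨by omega, g, hg, by omega, by omega, fun b hb => ?_, fun j' hj' hj'g => ?_⟩
        · have : b = true := (h₁.2 _ hb).2 (hsub j (Finset.mem_Ico.2 (by omega)))
          subst this
          exact hjh hb
        · exact ih (g - j') (by omega) j' (by omega) (by omega)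
  exact hx₂ ((h₂.2 _ (htrue (g - x) x (by omega) le_rfl)).1 rfl)

lemma consistent_unique {n s k : ℕ} (hs : 1 ≤ s) {h : History}
    (hG : ((hits h).take k).Nodup) (hGk : ((hits h).take k).length = k)
    (hGg : ∀ g ∈ (hits h).take k, ∃ i, g = i * s + 1)
    (hcand : refinementCandidates s k h = ∅) {S₁ S₂ : Finset ℕ}
    (h₁ : Consistent (unionsOfIntervals n s k) h S₁)
    (h₂ : Consistent (unionsOfIntervals n s k) h S₂) : S₁ = S₂ := by
  classical
  by_contra hne
  have hex : ∃ x, ¬ (x ∈ S₁ ↔ x ∈ S₂) := by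
    by_contra hall
    push Not at hall
    exact hne (Finset.ext hall)
  have hmin : ∀ y < Nat.find hex, y ∈ S₁ ↔ y ∈ S₂ := fun y hy => not_not.1 (Nat.find_min hex hy)
  have hx := Nat.find_spec hex
  by_cases hx₁ : Nat.find hex ∈ S₁
  · exact first_difference_false hs hG hGk hGg hcand h₁ h₂ hx₁ (fun h => hx (by tauto)) hmin
  · exact first_difference_false hs hG hGk hGg hcand h₂ h₁ (by tauto) hx₁
      fun y hy => (hmin y hy).symm

/-- The shape of the histories of the two-phase procedure: a search phase `h₁` and a refinement
phase `h₂`, with the costs of their answers. -/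
structure TwoPhase (n s k : ℕ) (c : History → Bool → ℝ) (x y w : ℝ) (h h₁ h₂ : History) :
    Prop where
  eq_append : h = h₁ ++ h₂
  grid : GridQueries s h₁
  hits_le : (hits h₁).length ≤ k
  search_done : h₂ = [] ∨ (hits h₁).length = k
  length_le : h₁.length * s + 1 ≤ n + s
  nodup : (h₂.map Prod.fst).Nodup
  near : ∀ q ∈ h₂.map Prod.fst, ∃ g ∈ hits h₁, q < g ∧ g < q + s
  spent_le : spent c h ≤ ((h₁.length : ℝ) - (hits h₁).length) * x + (hits h₁).length * y
    + h₂.length * w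

lemma exists_twoPhase {n s k : ℕ} (hs : 1 ≤ s) (hk1 : 1 ≤ k) (hn : 1 ≤ n) {δ : ℝ} {c : History → Bool → ℝ}
    {x y w : ℝ} (hcx : ∀ h, InSearch k h → c h false ≤ x) (hcy : ∀ h, InSearch k h → c h true ≤ y)
    (hcw : ∀ h b, ¬ InSearch k h → c h b ≤ w) {h : History}
    (hr : Reachable (intervalProcedure n s k δ) h) :
    ∃ h₁ h₂, TwoPhase n s k c x y w h h₁ h₂ := by
  induction hr with
  | nil =>
    exact ⟨[], [], rfl, by simp [GridQueries], by simp [hits], Or.inl rfl, by simp; omega, by simp,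
      by simp, by simp [hits]⟩
  | @append h b hr hns ih =>
    obtain ⟨h₁, h₂, T⟩ := ih
    have hlen : (hits h).length = (hits h₁).length + (hits h₂).length := by
      rw [T.eq_append, hits_append, List.length_append]
    by_cases hsearch : InSearch k h
    · have hlt : (hits h₁).length < k := by
        have : (hits h).length < k := hsearch
        omega
      have hnil : h₂ = [] := T.search_done.resolve_right hlt.ne
      have hh : h = h₁ := by rw [T.eq_append, hnil, List.append_nil]
      subst hh
      have hq : (intervalProcedure n s k δ).query h = h.length * s + 1 := by
        simp [intervalProcedure, intervalQuery, hsearch]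
      have hle : h.length * s + 1 ≤ n := by
        by_cases h0 : h = []
        · simpa [h0] using hn
        -- Failure to stop provides two consistent supports; one of them suffices.
        · unfold Stopped at hns
          push Not at hns
          obtain ⟨S₁, -, hS₁, -⟩ := hns h0
          exact next_grid_le hs T.grid hlt hS₁
      rw [hq]
      have hhits : (hits [(h.length * s + 1, b)]).length = if b then 1 else 0 := by
        cases b <;> simp [hits]
      have hsp := T.spent_le
      refine ⟨h ++ [(h.length * s + 1, b)], [], by simp, T.grid.append b, ?_, Or.inl rfl, ?_,
        by simp, by simp, ?_⟩
      · rw [hits_append, List.length_append, hhits]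
        split_ifs <;> omega
      · rw [List.length_append, List.length_singleton, Nat.succ_mul]
        omega
      · rw [spent_append, hits_append, List.length_append, List.length_append, hhits]
        simp only [hnil, List.length_nil, List.length_singleton] at hsp ⊢
        cases b
        · have := hcx h hsearch
          simp only [Bool.false_eq_true, if_false]
          push_cast at hsp ⊢
          linarith
        · have := hcy h hsearch
          simp only [if_true]
          push_cast at hsp ⊢
          linarith
    · have hge : k ≤ (hits h).length := not_lt.1 hsearch
      have hk : (hits h₁).length = k := by
        rcases T.search_done with h0 | h0
        · have := T.hits_le
          simp only [h0, hits, List.filter_nil, List.map_nil, List.length_nil, add_zero] at hlen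
          simp only [hits] at this hge ⊢
          omega
        · exact h0
      have htake : (hits h).take k = hits h₁ := by
        rw [T.eq_append, hits_append, ← hk, List.take_left']
        rfl
      have hcand : (refinementCandidates s k h).Nonempty := by
        by_contra hempty
        rw [Set.not_nonempty_iff_eq_empty] at hempty
        have h0 : h ≠ [] := by
          rintro rfl
          have : k ≤ 0 := hge
          omega
        refine hns ⟨h0, fun S₁ S₂ h₁' h₂' => consistent_unique hs ?_ ?_ ?_ hempty h₁' h₂'⟩
        · rw [htake]; exact T.grid.nodup hs
        · rw [htake, hk]
        · rw [htake]; exact fun g hg => T.grid.exists_of_mem hg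
      -- Nonemptiness excludes the default value 0 of `sInf ∅`.
      have hq : (intervalProcedure n s k δ).query h ∈ refinementCandidates s k h := by
        simp only [intervalProcedure, intervalQuery, hsearch, if_false]
        exact Nat.sInf_mem hcand
      set q := (intervalProcedure n s k δ).query h
      obtain ⟨-, g, hg, hqg, hgq, hnew, -⟩ := hq
      rw [htake] at hg
      have hsp := T.spent_le
      refine ⟨h₁, h₂ ++ [(q, b)], by rw [T.eq_append, List.append_assoc], T.grid, T.hits_le,
        Or.inr hk, T.length_le, ?_, ?_, ?_⟩
      · rw [List.map_append, List.nodup_append]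
        refine ⟨T.nodup, by simp, ?_⟩
        intro c hc d hd
        obtain ⟨⟨c', b'⟩, hp, rfl⟩ := List.mem_map.1 hc
        simp only [List.map_cons, List.map_nil, List.mem_singleton] at hd
        rw [hd]
        intro hcq
        simp only at hcq
        refine hnew b' ?_
        rw [T.eq_append, ← hcq]
        exact List.mem_append_right _ hp
      · intro c hc
        rw [List.map_append, List.mem_append] at hc
        rcases hc with hc | hc
        · exact T.near c hc
        · simp only [List.map_cons, List.map_nil, List.mem_singleton] at hc
          rw [hc]
          exact ⟨g, hg, hqg, hgq⟩
      · rw [spent_append, List.length_append, List.length_singleton]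
        have := hcw h b hsearch
        push_cast
        linarith

/-- The refinement queries are distinct and lie in windows of at most s - 1 points to the left of at
most k hits. -/
lemma TwoPhase.refinement_length_le {n s k : ℕ} {c : History → Bool → ℝ} {x y w : ℝ}
    {h h₁ h₂ : History} (T : TwoPhase n s k c x y w h h₁ h₂) : h₂.length ≤ k * (s - 1) := by
  have hsub : (h₂.map Prod.fst).toFinset ⊆
      (hits h₁).toFinset.biUnion fun g => Finset.Ico (g - (s - 1)) g := by
    intro q hq
    rw [List.mem_toFinset] at hq
    obtain ⟨g, hg, h1, h2⟩ := T.near q hq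
    exact Finset.mem_biUnion.2 ⟨g, List.mem_toFinset.2 hg, Finset.mem_Ico.2 (by omega)⟩
  calc h₂.length = (h₂.map Prod.fst).toFinset.card := by
        rw [List.toFinset_card_of_nodup T.nodup, List.length_map]
    _ ≤ _ := Finset.card_le_card hsub
    _ ≤ (hits h₁).toFinset.card * (s - 1) := by
        refine Finset.card_biUnion_le_card_mul _ _ _ fun g _ => ?_
        rw [Nat.card_Ico]
        omega
    _ ≤ k * (s - 1) :=
        Nat.mul_le_mul_right _ ((List.toFinset_card_le _).trans T.hits_le)

/-! ### Boundaries and error bounds of the tests -/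

/-- The gain α from log(1-α) ≤ -α is kept to pay for the overshoot. -/
lemma neg_lowerBoundary_add_le {α β : ℝ} (hα1 : α < 1) (hβ : 0 < β) :
    -lowerBoundary α β + α ≤ -Real.log β := by
  have := Real.log_le_sub_one_of_pos (sub_pos.2 hα1)
  rw [lowerBoundary, Real.log_div hβ.ne' (sub_pos.2 hα1).ne']
  linarith

lemma upperBoundary_add_le {α β : ℝ} (hα : 0 < α) (hβ1 : β < 1) :
    upperBoundary α β + β ≤ -Real.log α := by
  have := Real.log_le_sub_one_of_pos (sub_pos.2 hβ1)
  rw [upperBoundary, Real.log_div (sub_pos.2 hβ1).ne' hα.ne']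
  linarith

lemma exp_lowerBoundary {α β : ℝ} (hα1 : α < 1) (hβ : 0 < β) :
    Real.exp (lowerBoundary α β) = β / (1 - α) :=
  Real.exp_log (div_pos hβ (sub_pos.2 hα1))

lemma exp_neg_upperBoundary {α β : ℝ} (hα : 0 < α) (hβ1 : β < 1) :
    Real.exp (-upperBoundary α β) = α / (1 - β) := by
  rw [Real.exp_neg, upperBoundary, Real.exp_log (div_pos (sub_pos.2 hβ1) hα), inv_div]

lemma lowerBoundary_neg {α β : ℝ} (hβ : 0 < β) (hαβ : α + β < 1) (hα1 : α < 1) :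
    lowerBoundary α β < 0 := by
  refine Real.log_neg (div_pos hβ (sub_pos.2 hα1)) ?_
  rw [div_lt_one (sub_pos.2 hα1)]
  linarith

lemma upperBoundary_pos {α β : ℝ} (hα : 0 < α) (hαβ : α + β < 1) :
    0 < upperBoundary α β := by
  refine Real.log_pos ?_
  rw [one_lt_div hα]
  linarith

/-- The budget of the search phase and the refinement phase for the total precision. -/
lemma cost_budget {n s k L H R A B : ℝ} (hs : 1 ≤ s) (hA : 0 ≤ A) (hAB : A ≤ B)
    (hk : 1 ≤ k) (hL : L * s + 1 ≤ n + s) (hHk : H ≤ k) (hH : H = 0 ∨ 1 ≤ H)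
    (hR : R ≤ k * (s - 1)) :
    (L - H) * A + H * B + R * B ≤ n / s * A + k * s * B := by
  have hs0 : 0 < s := by linarith
  have hns : n / s * s = n := div_mul_cancel₀ n hs0.ne'
  have hB : 0 ≤ B := hA.trans hAB
  have hRB := mul_le_mul_of_nonneg_right hR hB
  rcases hH with rfl | hH
  -- With no hit, the possible extra query is paid for by the unused share kB of the hits.
  · have h1 : L ≤ n / s + 1 := by
      rw [← mul_le_mul_iff_left₀ hs0]
      linarith
    have h2 := mul_le_mul_of_nonneg_right h1 hA
    have h3 := mul_le_mul_of_nonneg_right hk hB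
    linarith
  · have h1 : L - H ≤ n / s := by
      rw [← mul_le_mul_iff_left₀ hs0, hns]
      have := mul_le_mul_of_nonneg_right hH hs0.le
      linarith
    have h2 := mul_le_mul_of_nonneg_right h1 hA
    have h3 := mul_le_mul_of_nonneg_right hHk hB
    linarith

/-- The error probabilities of all tests of the procedure add up to at most `δ`, for `δ = 1`. -/
lemma error_budget_aux {n s : ℝ} (hs : s = 1 ∨ 2 ≤ s) (hsn : s ≤ n) :
    (n - 1) / (2 * s * n) + 2 * n / (4 * n - 1) + (s - 1) / (4 * s - 1) ≤ 1 := by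
  rcases hs with rfl | hs
  · have h1 : 0 < 4 * n - 1 := by linarith
    have h2 : 0 < n := by linarith
    have h3 : (n - 1) / (2 * 1 * n) + 2 * n / (4 * n - 1) ≤ 1 := by
      rw [div_add_div _ _ (by positivity) h1.ne', div_le_one (by positivity)]
      nlinarith
    norm_num at h3 ⊢
    exact h3
  -- For s ≥ 2 the false alarms of the search take at most 1/4 and the other two terms together at
  -- most 3/4; for s = 1 the refinement term vanishes.
  · have hn : 0 < n := by linarith
    have hs1 : 0 < 4 * s - 1 := by linarith
    have hn1 : 0 < 4 * n - 1 := by linarith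
    have h1 : (n - 1) / (2 * s * n) ≤ 1 / 4 := by
      rw [div_le_div_iff₀ (by positivity) (by norm_num)]
      nlinarith
    have h2 : 2 * n / (4 * n - 1) ≤ 2 * s / (4 * s - 1) := by
      rw [div_le_div_iff₀ hn1 hs1]
      nlinarith
    have h3 : 2 * s / (4 * s - 1) + (s - 1) / (4 * s - 1) ≤ 3 / 4 := by
      rw [← add_div, div_le_div_iff₀ hs1 (by norm_num)]
      linarith
    linarith

/-- Here x bounds a false alarm in the search, y a miss in the search, and w either error in the
refinement. -/
lemma error_budget {n s k L H R δ x y w : ℝ} (hδ : 0 < δ) (hs : s = 1 ∨ 2 ≤ s) (hsn : s ≤ n)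
    (hk : 1 ≤ k) (hL : L * s + 1 ≤ n + s) (hHk : H ≤ k) (hH : H = 0 ∨ 1 ≤ H)
    (hR : R ≤ k * (s - 1)) (hHL : H ≤ L) (hx0 : 0 ≤ x) (hx : x ≤ δ / (2 * n)) (hy0 : 0 ≤ y)
    (hy : y ≤ δ / k * (2 * n / (4 * n - 1))) (hw0 : 0 ≤ w) (hw : w ≤ δ / (4 * (k * s) - 1)) :
    (L - H) * x + H * y + R * w ≤ δ := by
  have hs1 : 1 ≤ s := by rcases hs with rfl | hs <;> linarith
  have hs0 : 0 < s := by linarith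
  have hk0 : 0 < k := by linarith
  have hn0 : 0 < n := by linarith
  have hks : 1 ≤ k * s := by nlinarith
  have hRw : R * w ≤ δ * ((s - 1) / (4 * s - 1)) := by
    calc R * w ≤ k * (s - 1) * w := mul_le_mul_of_nonneg_right hR hw0
      _ ≤ k * (s - 1) * (δ / (4 * (k * s) - 1)) :=
        mul_le_mul_of_nonneg_left hw (mul_nonneg hk0.le (by linarith))
      _ ≤ δ * ((s - 1) / (4 * s - 1)) := by
        rw [mul_div_assoc', mul_div_assoc', div_le_div_iff₀ (by linarith) (by linarith)]
        have : 0 ≤ δ * (s - 1) * (k - 1) :=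
          mul_nonneg (mul_nonneg hδ.le (by linarith)) (by linarith)
        linarith
  rcases hH with rfl | hH
  · have hLn : L ≤ n := by nlinarith
    have h1 : (L - 0) * x ≤ δ / 2 := by
      calc (L - 0) * x ≤ n * (δ / (2 * n)) := by
            rw [sub_zero]
            exact mul_le_mul hLn hx hx0 hn0.le
        _ = δ / 2 := by field_simp
    have h2 : δ * ((s - 1) / (4 * s - 1)) ≤ δ * (1 / 4) := by
      refine mul_le_mul_of_nonneg_left ?_ hδ.le
      rw [div_le_div_iff₀ (by linarith) (by norm_num)]
      linarith
    linarith
  · have hLs : L - H ≤ (n - 1) / s := by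
      rw [le_div_iff₀ hs0]
      nlinarith
    have h1 : (L - H) * x ≤ δ * ((n - 1) / (2 * s * n)) := by
      calc (L - H) * x ≤ (n - 1) / s * (δ / (2 * n)) :=
            mul_le_mul hLs hx hx0 (div_nonneg (by linarith) hs0.le)
        _ = δ * ((n - 1) / (2 * s * n)) := by field_simp
    have h2 : H * y ≤ δ * (2 * n / (4 * n - 1)) := by
      calc H * y ≤ k * (δ / k * (2 * n / (4 * n - 1))) :=
            mul_le_mul hHk hy hy0 hk0.le
        _ = δ * (2 * n / (4 * n - 1)) := by field_simp
    have h3 := mul_le_mul_of_nonneg_left (error_budget_aux hs hsn) hδ.le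
    linarith

/-! ### The two budgets for the prescribed error levels -/

section TwoPhaseProcedure

variable {n s k : ℕ} {δ : ℝ}

lemma type_one_pos (hδ : 0 < δ) (hn : 1 ≤ n) : 0 < δ / (4 * n) := by
  have : (0 : ℝ) < n := by exact_mod_cast hn
  positivity

lemma type_one_le (hδ1 : δ ≤ 1) (hn : 1 ≤ n) : δ / (4 * n) ≤ 1 / 4 := by
  have : (1 : ℝ) ≤ n := by exact_mod_cast hn
  rw [div_le_div_iff₀ (by linarith) (by norm_num)]
  linarith

lemma intervalProcedure_beta_bounds (hs : 1 ≤ s) (hk : 1 ≤ k) (hksn : k * s ≤ n) (hδ : 0 < δ)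
    (hδ1 : δ ≤ 1) (h : History) :
    δ / (4 * n) ≤ (intervalProcedure n s k δ).β h ∧ (intervalProcedure n s k δ).β h ≤ 1 / 2 := by
  have hk' : (1 : ℝ) ≤ k := by exact_mod_cast hk
  have hs' : (1 : ℝ) ≤ s := by exact_mod_cast hs
  have hn' : (k : ℝ) * s ≤ n := by exact_mod_cast hksn
  have hks : (k : ℝ) ≤ k * s := by nlinarith
  unfold intervalProcedure
  simp only
  split_ifs
  · constructor
    · exact div_le_div_of_nonneg_left hδ.le (by linarith) (by linarith)
    · rw [div_le_div_iff₀ (by linarith) (by norm_num)]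
      linarith
  · constructor
    · exact div_le_div_of_nonneg_left hδ.le (by linarith) (by linarith)
    · rw [div_le_div_iff₀ (by linarith) (by norm_num)]
      linarith

/-- The costs of the answers of the two-phase procedure in the accounting of the precision. -/
noncomputable def answerCost (n s k : ℕ) (δ : ℝ) (h : History) (b : Bool) : ℝ :=
  (if b then upperAt (intervalProcedure n s k δ) h else -lowerAt (intervalProcedure n s k δ) h)
    -- The allowance for the overshoot, which dominates 2ρ for small Γ.
    + δ / (4 * n)

lemma answerCost_false_le (hs : 1 ≤ s) (hk : 1 ≤ k) (hksn : k * s ≤ n) (hδ : 0 < δ)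
    (hδ1 : δ ≤ 1) (h : History) :
    answerCost n s k δ h false ≤ -Real.log ((intervalProcedure n s k δ).β h) := by
  have hn : 1 ≤ n := (Nat.mul_pos hk hs).trans_le hksn
  have := type_one_le hδ1 hn
  have hα := type_one_pos hδ hn
  have hβ := intervalProcedure_beta_bounds hs hk hksn hδ hδ1 h
  exact neg_lowerBoundary_add_le (show δ / (4 * n) < 1 by linarith) (by linarith)

lemma answerCost_true_le (hs : 1 ≤ s) (hk : 1 ≤ k) (hksn : k * s ≤ n) (hδ : 0 < δ)
    (hδ1 : δ ≤ 1) (h : History) :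
    answerCost n s k δ h true ≤ Real.log (4 * n / δ) := by
  have hn : 1 ≤ n := (Nat.mul_pos hk hs).trans_le hksn
  have hα := type_one_pos hδ hn
  have hβ := intervalProcedure_beta_bounds hs hk hksn hδ hδ1 h
  have h1 := upperBoundary_add_le (β := (intervalProcedure n s k δ).β h) hα (by linarith)
  rw [← Real.log_inv, inv_div] at h1
  have h2 : answerCost n s k δ h true
      = upperBoundary (δ / (4 * n)) ((intervalProcedure n s k δ).β h) + δ / (4 * n) := rfl
  linarith

lemma spent_answerCost_le (hs : 1 ≤ s) (hk : 1 ≤ k) (hksn : k * s ≤ n) (hδ : 0 < δ)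
    (hδ1 : δ ≤ 1) {h : History} (hr : Reachable (intervalProcedure n s k δ) h) :
    spent (answerCost n s k δ) h
      ≤ n / s * Real.log (2 * k / δ) + k * s * Real.log (4 * n / δ) := by
  have hn : 1 ≤ n := (Nat.mul_pos hk hs).trans_le hksn
  have hk' : (1 : ℝ) ≤ k := by exact_mod_cast hk
  have hs' : (1 : ℝ) ≤ s := by exact_mod_cast hs
  have hn' : (k : ℝ) * s ≤ n := by exact_mod_cast hksn
  have hks : (k : ℝ) ≤ k * s := by nlinarith
  obtain ⟨h₁, h₂, T⟩ := exists_twoPhase (δ := δ) (c := answerCost n s k δ)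
    (x := Real.log (2 * k / δ)) (y := Real.log (4 * n / δ)) (w := Real.log (4 * n / δ))
    hs hk hn
    (fun h hh => by
      refine (answerCost_false_le hs hk hksn hδ hδ1 h).trans (le_of_eq ?_)
      simp only [intervalProcedure, hh, if_true]
      rw [← Real.log_inv, inv_div])
    (fun h _ => answerCost_true_le hs hk hksn hδ hδ1 h)
    (fun h b hh => by
      cases b
      · refine (answerCost_false_le hs hk hksn hδ hδ1 h).trans ?_
        simp only [intervalProcedure, hh, if_false]
        rw [← Real.log_inv, inv_div]
        refine Real.log_le_log (by positivity) ?_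
        gcongr
      · exact answerCost_true_le hs hk hksn hδ hδ1 h) hr
  refine T.spent_le.trans (cost_budget hs' ?_ ?_ hk' ?_ ?_ ?_ ?_)
  · refine Real.log_nonneg ?_
    rw [le_div_iff₀ hδ]
    linarith
  · refine Real.log_le_log (by positivity) ?_
    gcongr ?_ / _
    linarith
  · exact_mod_cast T.length_le
  · exact_mod_cast T.hits_le
  · rcases Nat.eq_zero_or_pos (hits h₁).length with h0 | h0
    · exact Or.inl (by exact_mod_cast h0)
    · exact Or.inr (by exact_mod_cast h0)
  · have := T.refinement_length_le
    rw [← Nat.cast_one, ← Nat.cast_sub hs]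
    exact_mod_cast this

lemma errorBound_true (hα1 : δ / (4 * n) < 1) {h : History}
    (hβ : 0 < (intervalProcedure n s k δ).β h) :
    errorBound (intervalProcedure n s k δ) h true
      = (intervalProcedure n s k δ).β h / (1 - δ / (4 * n)) :=
  exp_lowerBoundary hα1 hβ

lemma errorBound_false (hα : 0 < δ / (4 * n)) {h : History}
    (hβ : (intervalProcedure n s k δ).β h < 1) :
    errorBound (intervalProcedure n s k δ) h false
      = δ / (4 * n) / (1 - (intervalProcedure n s k δ).β h) :=
  exp_neg_upperBoundary hα hβ

lemma spent_errorBound_le (hs : 1 ≤ s) (hk : 1 ≤ k) (hksn : k * s ≤ n) (hδ : 0 < δ)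
    (hδ1 : δ ≤ 1) {h : History} (hr : Reachable (intervalProcedure n s k δ) h) :
    spent (errorBound (intervalProcedure n s k δ)) h ≤ δ := by
  have hn : 1 ≤ n := (Nat.mul_pos hk hs).trans_le hksn
  have hk' : (1 : ℝ) ≤ k := by exact_mod_cast hk
  have hs' : (1 : ℝ) ≤ s := by exact_mod_cast hs
  have hn1 : (1 : ℝ) ≤ n := by exact_mod_cast hn
  have hn' : (k : ℝ) * s ≤ n := by exact_mod_cast hksn
  have hks : (k : ℝ) ≤ k * s := by nlinarith
  have hα := type_one_pos hδ hn
  have hα4 := type_one_le hδ1 hn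
  have hβ := fun h => intervalProcedure_beta_bounds hs hk hksn hδ hδ1 h
  have hone : 1 - δ / (4 * n) ≥ (4 * n - 1) / (4 * n) := by
    rw [ge_iff_le, sub_div, div_self (by positivity)]
    gcongr
  have hw0 : 0 ≤ δ / (4 * (k * s) - 1) := div_nonneg hδ.le (by linarith)
  obtain ⟨h₁, h₂, T⟩ := exists_twoPhase (δ := δ) (c := errorBound (intervalProcedure n s k δ))
    (x := δ / (2 * n)) (y := δ / k * (2 * n / (4 * n - 1))) (w := δ / (4 * (k * s) - 1))
    hs hk hn
    -- Since β ≤ 1/2, a false alarm has bound α/(1-β) ≤ 2α.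
    (fun h _ => by
      rw [errorBound_false hα (by linarith [hβ h]), div_le_div_iff₀ (by linarith [hβ h])
        (by linarith), div_mul_eq_mul_div, div_le_iff₀ (by positivity)]
      nlinarith [mul_pos hδ (by linarith : (0 : ℝ) < n), (hβ h).2])
    (fun h hh => by
      rw [errorBound_true (by linarith) (by linarith [hβ h])]
      simp only [intervalProcedure, hh, if_true]
      calc δ / (2 * k) / (1 - δ / (4 * n)) ≤ δ / (2 * k) / ((4 * n - 1) / (4 * n)) := by
            gcongr
            exact div_pos (by linarith) (by linarith)
        _ = δ / k * (2 * n / (4 * n - 1)) := by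
            have : (4 * n - 1 : ℝ) ≠ 0 := by linarith
            field_simp
            ring)
    -- Both error bounds are at most δ/(4ks - 1), because ks ≤ n and δ ≤ 1.
    (fun h b hh => by
      cases b
      · rw [errorBound_false hα (by linarith [hβ h])]
        have hb := (hβ h).2
        simp only [intervalProcedure, hh, if_false] at hb ⊢
        rw [div_div]
        refine div_le_div_of_nonneg_left hδ.le (by linarith) ?_
        have h1 : 4 * (k * s : ℝ) * (1 - δ / (4 * (k * s))) = 4 * (k * s) - δ := by
          field_simp
        have h2 : 4 * (k * s : ℝ) * (1 - δ / (4 * (k * s)))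
            ≤ 4 * n * (1 - δ / (4 * (k * s))) :=
          mul_le_mul_of_nonneg_right (by linarith) (by linarith)
        linarith
      · rw [errorBound_true (by linarith) (by linarith [hβ h])]
        simp only [intervalProcedure, hh, if_false]
        rw [div_div]
        refine div_le_div_of_nonneg_left hδ.le (by linarith) ?_
        have h1 : 4 * (n : ℝ) * (δ / (4 * n)) = δ := by field_simp
        have h2 : 4 * (k * s : ℝ) * (δ / (4 * n)) ≤ 4 * n * (δ / (4 * n)) :=
          mul_le_mul_of_nonneg_right (by linarith) hα.le
        linarith) hr
  refine T.spent_le.trans (error_budget (n := n) (s := s) (k := k) hδ ?_ ?_ hk' ?_ ?_ ?_ ?_ ?_ ?_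
    le_rfl ?_ le_rfl hw0 le_rfl)
  · rcases hs.eq_or_lt with h1 | h1
    · exact Or.inl (by exact_mod_cast h1.symm)
    · exact Or.inr (by exact_mod_cast h1)
  · nlinarith
  · exact_mod_cast T.length_le
  · exact_mod_cast T.hits_le
  · rcases Nat.eq_zero_or_pos (hits h₁).length with h0 | h0
    · exact Or.inl (by exact_mod_cast h0)
    · exact Or.inr (by exact_mod_cast h0)
  · have := T.refinement_length_le
    rw [← Nat.cast_one, ← Nat.cast_sub hs]
    exact_mod_cast this
  · exact_mod_cast length_hits_le h₁
  · positivity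
  · exact mul_nonneg (by positivity) (div_nonneg (by linarith) (by linarith))

end TwoPhaseProcedure

end AdaptiveSensing

/-! ### The main theorem -/

open AdaptiveSensing
theorem proposition5 (n s k : ℕ) (hs : 1 ≤ s) (hk : 1 ≤ k) (m μ δ : ℝ) (hm : 0 < m)
    (hμ : 0 < μ) (hδ : 0 < δ) (hδ1 : δ ≤ 1)
    (hμ_ge : Real.sqrt (2 * n / (s * m) * Real.log (2 * k / δ)
      + 2 * k * s / m * Real.log (4 * n / δ)) ≤ μ) :
    ∃ Γ₀ : ℝ, 0 < Γ₀ ∧ ∀ Γ : ℝ, 0 < Γ → Γ ≤ Γ₀ →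
      ∀ (Ω : Type*) [MeasurableSpace Ω] (P : Measure Ω) [IsProbabilityMeasure P]
        (W : ℕ → Ω → ℝ), IsStdNormalNoise P W →
        ∀ S ∈ unionsOfIntervals n s k,
          P {ω | estimator (intervalProcedure n s k δ) μ Γ S (fun j => W j ω) ≠ S}
              ≤ ENNReal.ofReal δ ∧
          ∫⁻ ω, ∑' j, ENNReal.ofReal
              (precision (intervalProcedure n s k δ) μ Γ S (fun j => W j ω) j) ∂P
            ≤ ENNReal.ofReal m := by
  -- Otherwise the class is empty and any Γ₀ works.
  by_cases hksn : k * s ≤ n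
  swap
  · exact ⟨1, one_pos, fun Γ _ _ Ω _ P _ W _ S hS =>
      absurd (mul_le_of_mem_unionsOfIntervals hS) hksn⟩
  have hn : 1 ≤ n := (Nat.mul_pos hk hs).trans_le hksn
  have hn0 : (0 : ℝ) < n := by exact_mod_cast hn
  have hs0 : (0 : ℝ) < s := by exact_mod_cast hs
  -- Chosen so that 2√Γ μ ≤ δ/4n, the slack available in each test.
  refine ⟨(δ / (8 * n * μ)) ^ 2, by positivity, fun Γ hΓ hΓle Ω _ P _ W hW S hS => ?_⟩
  have hα := type_one_pos hδ hn
  have hα4 := type_one_le hδ1 hn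
  have hβ := fun h => intervalProcedure_beta_bounds hs hk hksn hδ hδ1 h
  have hl : ∀ h, lowerAt (intervalProcedure n s k δ) h < 0 := fun h =>
    lowerBoundary_neg (by linarith [hβ h])
      (show δ / (4 * n) + (intervalProcedure n s k δ).β h < 1 by linarith [hβ h])
      (show δ / (4 * n) < 1 by linarith)
  have hu : ∀ h, 0 < upperAt (intervalProcedure n s k δ) h := fun h =>
    upperBoundary_pos hα
      (show δ / (4 * n) + (intervalProcedure n s k δ).β h < 1 by linarith [hβ h])
  have hρ : 2 * (√Γ * μ) ≤ δ / (4 * n) := by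
    have h1 : √Γ ≤ δ / (8 * n * μ) := Real.sqrt_le_iff.2 ⟨by positivity, hΓle⟩
    calc 2 * (√Γ * μ) ≤ 2 * (δ / (8 * n * μ) * μ) := by gcongr
      _ = δ / (4 * n) := by field_simp; norm_num
  have hcost := lintegral_precision_le hW hΓ hμ (by linarith) hl hu
    (c := answerCost n s k δ)
    (fun h => add_le_add_right hρ _) (fun h => add_le_add_right hρ _)
    (fun h hr => spent_answerCost_le hs hk hksn hδ hδ1 hr) S
  refine ⟨measure_estimator_ne_le hW hΓ hl hu
    (fun h hr => spent_errorBound_le hs hk hksn hδ hδ1 hr) hS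
    (hcost.trans_lt ENNReal.ofReal_lt_top).ne, hcost.trans (ENNReal.ofReal_le_ofReal ?_)⟩
  have h1 := (Real.sqrt_le_left hμ.le).1 hμ_ge
  rw [div_le_iff₀ (by positivity)]
  calc 2 * (n / s * Real.log (2 * k / δ) + k * s * Real.log (4 * n / δ))
      = m * (2 * n / (s * m) * Real.log (2 * k / δ)
        + 2 * k * s / m * Real.log (4 * n / δ)) := by field_simp
    _ ≤ m * μ ^ 2 := by gcongr
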